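/- Let $d\ge 1$, let $\Omega\subset\mathbb{R}^d$ be a bounded Lipschitz domain, let $s\in(0,1)$ with $s\neq\frac12$, and let $\alpha,\beta>0$. Put $c_{d,s}=\frac{s2^{2s}\Gamma(s+\frac d2)}{\pi^{d/2}\Gamma(1-s)}$ and, for $D=\Omega$ or $D=\mathbb{R}^d$, let $$H^s(D)=\Big\{w\in L^2(D):\ \frac{|w(x)-w(y)|}{|x-y|^{\frac d2+s}}\in L^2(D\times D)\Big\},\qquad (u,w)_{H^s(D)}=\int_D uw\,dx+\frac{c_{d,s}}2\int_D\int_D\frac{(u(x)-u(y))(w(x)-w(y))}{|x-y|^{d+2s}}\,dy\,dx .$$ Let $W$ be any one of the following three Hilbert spaces: 1. $H^s_0(\Omega)$, the closure of $C_c^\infty(\Omega)$ in $H^s(\Omega)$, with the inner product of $H^s(\Omega)$; 2. $\tilde H^s(\Omega)=\{w\in H^s(\mathbb{R}^d): w=0 \text{ a.e. on } \mathbb{R}^d\setminus\Omega\}$, with the inner product of $H^s(\mathbb{R}^d)$; 3. the spectral space $\mathbb{H}^s(\Omega)=\{w=\sum_n w_n\phi_n\in L^2(\Omega):\ \|w\|^2_{\mathbb{H}^s(\Omega)}=\sum_n\lambda_n^s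 w_n^2<\infty\}$, where $w_n=\int_\Omega w\phi_n\,dx$ and $(\phi_n)$ is an $L^2(\Omega)$-orthonormal system of all eigenfunctions (counted with multiplicity) of $-\Delta$ on $\Omega$ with zero Dirichlet boundary conditions, to the eigenvalues $\lambda_n$, with the inner product $(u,w)=\sum_n\lambda_n^su_nw_n$. Let $F:W\to\mathbb{R}$ be weakly (sequentially) lower semicontinuous, bounded from below by an affine function (there are $g\in W^*$ and $c\in\mathbb{R}$ with $F(w)\ge g(w)+c$ for all $w\in W$) and continuously Fréchet differentiable. Then the problem $$\min_{w\in W}\ F(w)+\frac\alpha2\|w\|_W^2+\beta\int_\Omega|w|^0\,dx ,\qquad 0^0:=0,$$ has a (global) solution, i.e. its infimum over $W$ is attained. -/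

import Mathlib

open MeasureTheory Filter Topology
open scoped ContDiff ENNReal

noncomputable section

namespace FracSob

/-- The Euclidean space `ℝ^d`. -/
abbrev Eucl (d : ℕ) : Type := EuclideanSpace ℝ (Fin d)

/-! ### Domains and test functions -/

/-- A bounded Lipschitz domain: a nonempty, connected, bounded open set which near each of its
boundary points is, in suitable orthonormal coordinates, the set of points lying strictly below the
graph of a Lipschitz function. Here `e` is the unit vector of the vertical direction, `⟪e, y⟫` is
the vertical coordinate of `y` and `y - ⟪e, y⟫ e` its horizontal part. -/
structure IsBoundedLipschitzDomain {d : ℕ} (Ω : Set (Eucl d)) : Prop where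
  isOpen : IsOpen Ω
  isConnected : IsConnected Ω
  isBounded : Bornology.IsBounded Ω
  lipschitz_boundary : ∀ x ∈ frontier Ω, ∃ e : Eucl d, ‖e‖ = 1 ∧
    ∃ (K : NNReal) (γ : Eucl d → ℝ), LipschitzWith K γ ∧
      ∃ U : Set (Eucl d), IsOpen U ∧ x ∈ U ∧
        ∀ y ∈ U, (y ∈ Ω ↔ inner ℝ e y < γ (y - (inner ℝ e y : ℝ) • e))

/-- `φ ∈ C_c^∞(Ω)`. -/
structure IsTestFunction {d : ℕ} (Ω : Set (Eucl d)) (φ : Eucl d → ℝ) : Prop where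
  contDiff : ContDiff ℝ ∞ φ
  hasCompactSupport : HasCompactSupport φ
  tsupport_subset : tsupport φ ⊆ Ω

/-- The Hilbert space `L²(Ω)`. -/
abbrev L2 {d : ℕ} (Ω : Set (Eucl d)) : Type := Lp ℝ 2 (volume.restrict Ω)

/-! ### The integral fractional Sobolev space `H^s(Ω)` -/

/-- Lebesgue measure on `Ω × Ω`. -/
abbrev prodVolume {d : ℕ} (Ω : Set (Eucl d)) : Measure (Eucl d × Eucl d) :=
  (volume.restrict Ω).prod (volume.restrict Ω)

/-- The function `(x, y) ↦ (w(x) - w(y)) / |x - y|^{d/2 + s}`. -/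
def diffQuotient {d : ℕ} (s : ℝ) (w : Eucl d → ℝ) (z : Eucl d × Eucl d) : ℝ :=
  (w z.1 - w z.2) / ‖z.1 - z.2‖ ^ ((d : ℝ) / 2 + s)

/-- The constant `c_{d,s} = s 2^{2s} Γ(s + d/2) / (π^{d/2} Γ(1-s))`. -/
def fracConst (d : ℕ) (s : ℝ) : ℝ :=
  s * (2 : ℝ) ^ (2 * s) * Real.Gamma (s + (d : ℝ) / 2) /
    (Real.pi ^ ((d : ℝ) / 2) * Real.Gamma (1 - s))

theorem fracConst_nonneg (d : ℕ) (s : Set.Ioo (0 : ℝ) 1) : 0 ≤ fracConst d s := by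
  have h0 := s.2.1
  have h1 := s.2.2
  have hg : 0 < Real.Gamma (1 - (s : ℝ)) := Real.Gamma_pos_of_pos (by linarith)
  have hg' : 0 < Real.Gamma ((s : ℝ) + (d : ℝ) / 2) := Real.Gamma_pos_of_pos (by positivity)
  unfold fracConst
  positivity

theorem diffQuotient_ae_congr {d : ℕ} {Ω : Set (Eucl d)} (s : ℝ) {u w : Eucl d → ℝ}
    (h : u =ᵐ[volume.restrict Ω] w) :
    diffQuotient s u =ᵐ[prodVolume Ω] diffQuotient s w := by
  have h1 : ∀ᵐ z ∂(prodVolume Ω), u z.1 = w z.1 :=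
    Measure.quasiMeasurePreserving_fst.ae h
  have h2 : ∀ᵐ z ∂(prodVolume Ω), u z.2 = w z.2 :=
    Measure.quasiMeasurePreserving_snd.ae h
  filter_upwards [h1, h2] with z hz1 hz2
  simp only [diffQuotient, hz1, hz2]

theorem diffQuotient_add {d : ℕ} {Ω : Set (Eucl d)} (s : ℝ) (u w : L2 Ω) :
    diffQuotient s (u + w : L2 Ω) =ᵐ[prodVolume Ω]
      fun z => diffQuotient s u z + diffQuotient s w z := by
  refine (diffQuotient_ae_congr s (Lp.coeFn_add u w)).trans (Eventually.of_forall fun z => ?_)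
  simp only [diffQuotient, Pi.add_apply]
  ring

theorem diffQuotient_smul {d : ℕ} {Ω : Set (Eucl d)} (s : ℝ) (a : ℝ) (w : L2 Ω) :
    diffQuotient s (a • w : L2 Ω) =ᵐ[prodVolume Ω] fun z => a * diffQuotient s w z := by
  refine (diffQuotient_ae_congr s (Lp.coeFn_smul a w)).trans (Eventually.of_forall fun z => ?_)
  simp only [diffQuotient, Pi.smul_apply, smul_eq_mul]
  ring

/-- `H^s(Ω)` as a linear subspace of `L²(Ω)`: those `w` for which
`(w(x) - w(y)) / |x - y|^{d/2+s}` belongs to `L²(Ω × Ω)`. -/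
def hsSubmodule {d : ℕ} (Ω : Set (Eucl d)) (s : Set.Ioo (0 : ℝ) 1) : Submodule ℝ (L2 Ω) where
  carrier := {w | MemLp (diffQuotient s w) 2 (prodVolume Ω)}
  zero_mem' := by
    have h : diffQuotient s ((0 : L2 Ω) : Eucl d → ℝ) =ᵐ[prodVolume Ω] fun _ => 0 :=
      (diffQuotient_ae_congr s (Lp.coeFn_zero ℝ 2 _)).trans
        (Eventually.of_forall fun z => by simp [diffQuotient])
    exact (memLp_congr_ae h).2 MemLp.zero
  add_mem' := fun {u w} hu hw => (memLp_congr_ae (diffQuotient_add s u w)).2 (MemLp.add hu hw)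
  smul_mem' := fun a w hw =>
    (memLp_congr_ae (diffQuotient_smul s a w)).2 (MemLp.const_mul hw a)

/-- The fractional Sobolev space `H^s(Ω)`. It is a type of its own, since it does not carry the
norm of `L²(Ω)`; its norm is the one induced by the inner product `Hs.innerHs` below. -/
def Hs {d : ℕ} (Ω : Set (Eucl d)) (s : Set.Ioo (0 : ℝ) 1) : Type := hsSubmodule Ω s

namespace Hs

variable {d : ℕ} {Ω : Set (Eucl d)} {s : Set.Ioo (0 : ℝ) 1}

instance : AddCommGroup (Hs Ω s) := inferInstanceAs (AddCommGroup (hsSubmodule Ω s))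

instance : Module ℝ (Hs Ω s) := inferInstanceAs (Module ℝ (hsSubmodule Ω s))

/-- The inclusion `H^s(Ω) ⊆ L²(Ω)`. -/
def toL2 : Hs Ω s →ₗ[ℝ] L2 Ω := (hsSubmodule Ω s).subtype

/-- The inner product
`(u, w) = ∫_Ω u w dx + (c_{d,s} / 2) ∫_Ω ∫_Ω (u(x)-u(y)) (w(x)-w(y)) / |x-y|^{d+2s} dy dx`. -/
def innerHs (u w : Hs Ω s) : ℝ :=
  (∫ x in Ω, toL2 u x * toL2 w x) +
    fracConst d s / 2 * ∫ z, (toL2 u z.1 - toL2 u z.2) * (toL2 w z.1 - toL2 w z.2) /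
      ‖z.1 - z.2‖ ^ ((d : ℝ) + 2 * (s : ℝ)) ∂(prodVolume Ω)

theorem innerHs_eq (u w : Hs Ω s) : innerHs u w = inner ℝ (toL2 u) (toL2 w) +
    fracConst d s / 2 *
      ∫ z, diffQuotient s (toL2 u) z * diffQuotient s (toL2 w) z ∂(prodVolume Ω) := by
  unfold innerHs
  congr 1
  · rw [L2.inner_def]
    refine integral_congr_ae (Eventually.of_forall fun x => ?_)
    simp [mul_comm]
  · congr 1
    refine integral_congr_ae (Eventually.of_forall fun z => ?_)
    have h : ‖z.1 - z.2‖ ^ ((d : ℝ) + 2 * (s : ℝ)) =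
        ‖z.1 - z.2‖ ^ ((d : ℝ) / 2 + s) * ‖z.1 - z.2‖ ^ ((d : ℝ) / 2 + s) := by
      rw [← pow_two, ← Real.rpow_mul_natCast (norm_nonneg _)]
      congr 1
      push_cast
      ring
    simp only [diffQuotient, h]
    rw [div_mul_div_comm]

theorem integrable_mul (u w : Hs Ω s) :
    Integrable (fun z => diffQuotient s (toL2 u) z * diffQuotient s (toL2 w) z)
      (prodVolume Ω) :=
  MemLp.integrable_mul (p := 2) (q := 2) u.2 w.2

/-- The inner product space structure of `H^s(Ω)`. -/
@[reducible] def core : InnerProductSpace.Core ℝ (Hs Ω s) where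
  inner := innerHs
  conj_inner_symm u w := by
    simp only [conj_trivial, innerHs_eq, real_inner_comm, mul_comm]
  re_inner_nonneg u := by
    simp only [innerHs_eq, RCLike.re_to_real]
    have h1 : 0 ≤ inner ℝ (toL2 u) (toL2 u) := real_inner_self_nonneg
    have h2 := fracConst_nonneg d s
    have h3 : 0 ≤ ∫ z, diffQuotient s (toL2 u) z * diffQuotient s (toL2 u) z ∂(prodVolume Ω) :=
      integral_nonneg fun z => mul_self_nonneg _
    positivity
  add_left u v w := by
    simp only [innerHs_eq, map_add, inner_add_left]
    have h : ∫ z, diffQuotient s (toL2 u + toL2 v : L2 Ω) z * diffQuotient s (toL2 w) z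
          ∂(prodVolume Ω) =
        (∫ z, diffQuotient s (toL2 u) z * diffQuotient s (toL2 w) z ∂(prodVolume Ω)) +
          ∫ z, diffQuotient s (toL2 v) z * diffQuotient s (toL2 w) z ∂(prodVolume Ω) := by
      rw [← integral_add (integrable_mul u w) (integrable_mul v w)]
      refine integral_congr_ae ?_
      filter_upwards [diffQuotient_add (s : ℝ) (toL2 u) (toL2 v)] with z hz
      rw [hz]
      ring
    rw [h]
    ring
  smul_left u w a := by
    simp only [innerHs_eq, map_smul, real_inner_smul_left, conj_trivial]
    have h : ∫ z, diffQuotient s (a • toL2 u : L2 Ω) z * diffQuotient s (toL2 w) z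
          ∂(prodVolume Ω) =
        a * ∫ z, diffQuotient s (toL2 u) z * diffQuotient s (toL2 w) z ∂(prodVolume Ω) := by
      rw [← integral_const_mul]
      refine integral_congr_ae ?_
      filter_upwards [diffQuotient_smul (s : ℝ) a (toL2 u)] with z hz
      rw [hz]
      ring
    rw [h]
    ring
  definite u hu := by
    rw [innerHs_eq] at hu
    have h1 : 0 ≤ inner ℝ (toL2 u) (toL2 u) := real_inner_self_nonneg
    have h2 := fracConst_nonneg d s
    have h3 : 0 ≤ ∫ z, diffQuotient s (toL2 u) z * diffQuotient s (toL2 u) z ∂(prodVolume Ω) :=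
      integral_nonneg fun z => mul_self_nonneg _
    have h4 : 0 ≤ fracConst d s / 2 *
      ∫ z, diffQuotient s (toL2 u) z * diffQuotient s (toL2 u) z ∂(prodVolume Ω) := by positivity
    have h5 : inner ℝ (toL2 u) (toL2 u) = 0 := by linarith
    exact Subtype.ext (inner_self_eq_zero.1 h5)

instance : NormedAddCommGroup (Hs Ω s) := core.toNormedAddCommGroup

instance : InnerProductSpace ℝ (Hs Ω s) := InnerProductSpace.ofCore core.toCore

end Hs

/-! ### The spaces `H_0^s(Ω)` and `H̃^s(Ω)` -/

/-- The elements of `H^s(Ω)` that have a representative in `C_c^∞(Ω)`. -/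
def testHs {d : ℕ} (Ω : Set (Eucl d)) (s : Set.Ioo (0 : ℝ) 1) : Set (Hs Ω s) :=
  {w | ∃ φ : Eucl d → ℝ, IsTestFunction Ω φ ∧ Hs.toL2 w =ᵐ[volume.restrict Ω] φ}

/-- `H_0^s(Ω)`: the closure of (the linear subspace) `C_c^∞(Ω)` in `H^s(Ω)`, with the inner
product of `H^s(Ω)`. -/
def H0s {d : ℕ} (Ω : Set (Eucl d)) (s : Set.Ioo (0 : ℝ) 1) : Submodule ℝ (Hs Ω s) :=
  (Submodule.span ℝ (testHs Ω s)).topologicalClosure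

/-- `H̃^s(Ω)`: the elements of `H^s(ℝ^d)` that vanish almost everywhere on `ℝ^d \ Ω`, with the
inner product of `H^s(ℝ^d)`. -/
def HTilde {d : ℕ} (Ω : Set (Eucl d)) (s : Set.Ioo (0 : ℝ) 1) :
    Submodule ℝ (Hs (Set.univ : Set (Eucl d)) s) where
  carrier := {w | ∀ᵐ x ∂(volume : Measure (Eucl d)), x ∉ Ω → Hs.toL2 w x = 0}
  zero_mem' := by
    simp
  add_mem' := fun {u w} hu hw => by
    have h := Lp.coeFn_add (Hs.toL2 u) (Hs.toL2 w)
    replace h := ae_mono (Measure.restrict_univ (μ := (volume : Measure (Eucl d)))).ge h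
    simp only [Set.mem_ofPred_eq, map_add]
    filter_upwards [h, hu, hw] with x hx hux hwx hxΩ
    rw [hx, Pi.add_apply, hux hxΩ, hwx hxΩ, add_zero]
  smul_mem' := fun a w hw => by
    have h := Lp.coeFn_smul a (Hs.toL2 w)
    replace h := ae_mono (Measure.restrict_univ (μ := (volume : Measure (Eucl d)))).ge h
    simp only [Set.mem_ofPred_eq, map_smul]
    filter_upwards [h, hw] with x hx hwx hxΩ
    rw [hx, Pi.smul_apply, hwx hxΩ, smul_zero]

/-! ### The spectral fractional Sobolev space -/

/-- `w ∈ H_0^1(Ω)` with weak gradient `G`: there are `φ_n ∈ C_c^∞(Ω)` with `φ_n → w` in `L²(Ω)`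
and `∇φ_n → G` in `L²(Ω; ℝ^d)`. -/
structure HasH01Gradient {d : ℕ} (Ω : Set (Eucl d)) (w : Eucl d → ℝ) (G : Eucl d → Eucl d) :
    Prop where
  memLp : MemLp w 2 (volume.restrict Ω)
  memLp_grad : MemLp G 2 (volume.restrict Ω)
  approx : ∃ φ : ℕ → Eucl d → ℝ, (∀ n, IsTestFunction Ω (φ n)) ∧
    Tendsto (fun n => eLpNorm (φ n - w) 2 (volume.restrict Ω)) atTop (𝓝 0) ∧
    Tendsto (fun n => eLpNorm (gradient (φ n) - G) 2 (volume.restrict Ω)) atTop (𝓝 0)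

/-- `w` is a weak solution of `-Δ w = lam w` in `Ω`, `w = 0` on `∂Ω`, that is: `w ∈ H_0^1(Ω)` and
`∫_Ω ∇w · ∇v dx = lam ∫_Ω w v dx` for all `v ∈ C_c^∞(Ω)`. -/
def IsDirichletSolution {d : ℕ} (Ω : Set (Eucl d)) (lam : ℝ) (w : Eucl d → ℝ) : Prop :=
  ∃ G : Eucl d → Eucl d, HasH01Gradient Ω w G ∧
    ∀ v : Eucl d → ℝ, IsTestFunction Ω v →
      ∫ x in Ω, inner ℝ (G x) (gradient v x) = lam * ∫ x in Ω, w x * v x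

/-- The eigenspace of the Dirichlet Laplacian on `Ω` for the eigenvalue `lam`, as a closed subspace
of `L²(Ω)`; it is `{0}` if `lam` is not an eigenvalue. (The solutions already form a closed linear
subspace, so that passing to the closed linear span adds nothing.) -/
def dirichletEigenspace {d : ℕ} (Ω : Set (Eucl d)) (lam : ℝ) : Submodule ℝ (L2 Ω) :=
  (Submodule.span ℝ {w : L2 Ω | IsDirichletSolution Ω lam w}).topologicalClosure

instance {d : ℕ} (Ω : Set (Eucl d)) (lam : ℝ) : CompleteSpace (dirichletEigenspace Ω lam) :=
  (Submodule.isClosed_topologicalClosure _).completeSpace_coe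

/-- The orthogonal projection `P_lam w` in `L²(Ω)` onto the eigenspace of `lam`. For an
orthonormal basis `φ_n` of Dirichlet eigenfunctions with eigenvalues `λ_n`, and
`w_n = ∫_Ω w φ_n dx`, this is `∑ w_n φ_n` over the `n` with `λ_n = lam`; hence
`‖P_lam w‖² = ∑ w_n²` over these `n`. -/
def eigenProj {d : ℕ} (Ω : Set (Eucl d)) (lam : ℝ) : L2 Ω →L[ℝ] L2 Ω :=
  (dirichletEigenspace Ω lam).starProjection

/-- The positive reals; on a bounded domain all Dirichlet eigenvalues are among them. -/
abbrev PosReal : Type := {lam : ℝ // 0 < lam}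

/-- The spectral space `ℍ^s(Ω)` as a linear subspace of `L²(Ω)`: those `w` that are the sum of
their eigenfunction expansion (they lie in the closed linear span of the eigenfunctions) and
satisfy `∑_n λ_n^s w_n² < ∞`. The sum is grouped by eigenvalues, so that it does not depend on a
choice of an orthonormal basis of eigenfunctions. -/
def spectralSubmodule {d : ℕ} (Ω : Set (Eucl d)) (s : Set.Ioo (0 : ℝ) 1) :
    Submodule ℝ (L2 Ω) where
  carrier := {w | w ∈ (⨆ lam : PosReal, dirichletEigenspace Ω lam).topologicalClosure ∧
    Summable fun lam : PosReal => (lam : ℝ) ^ (s : ℝ) * ‖eigenProj Ω lam w‖ ^ 2}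
  zero_mem' := ⟨Submodule.zero_mem _, by simp⟩
  add_mem' := fun {u w} hu hw => by
    refine ⟨Submodule.add_mem _ hu.1 hw.1, ?_⟩
    refine Summable.of_nonneg_of_le (fun lam => ?_) (fun lam => ?_)
      ((hu.2.add hw.2).mul_left 2)
    · have := Real.rpow_nonneg lam.2.le (s : ℝ)
      positivity
    · have h := Real.rpow_nonneg lam.2.le (s : ℝ)
      rw [map_add]
      have h1 : ‖eigenProj Ω lam u + eigenProj Ω lam w‖ ^ 2 ≤
          2 * (‖eigenProj Ω lam u‖ ^ 2 + ‖eigenProj Ω lam w‖ ^ 2) := by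
        have h2 := norm_add_le (eigenProj Ω lam u) (eigenProj Ω lam w)
        have h3 := norm_nonneg (eigenProj Ω lam u + eigenProj Ω lam w)
        nlinarith [sq_nonneg (‖eigenProj Ω lam u‖ - ‖eigenProj Ω lam w‖)]
      calc _ ≤ (lam : ℝ) ^ (s : ℝ) *
            (2 * (‖eigenProj Ω lam u‖ ^ 2 + ‖eigenProj Ω lam w‖ ^ 2)) :=
            mul_le_mul_of_nonneg_left h1 h
        _ = _ := by ring
  smul_mem' := fun a w hw => by
    refine ⟨Submodule.smul_mem _ a hw.1, ?_⟩
    refine (hw.2.mul_left (a ^ 2)).congr fun lam => ?_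
    rw [map_smul, norm_smul, mul_pow, Real.norm_eq_abs, sq_abs]
    ring

/-- The spectral fractional Sobolev space `ℍ^s(Ω)`. It is a type of its own, since it does not
carry the norm of `L²(Ω)`; its norm is the one induced by `SpecHs.innerSpec` below, that is
`‖w‖² = ∑_n λ_n^s w_n²`. -/
def SpecHs {d : ℕ} (Ω : Set (Eucl d)) (s : Set.Ioo (0 : ℝ) 1) : Type := spectralSubmodule Ω s

namespace SpecHs

variable {d : ℕ} {Ω : Set (Eucl d)} {s : Set.Ioo (0 : ℝ) 1}

instance : AddCommGroup (SpecHs Ω s) := inferInstanceAs (AddCommGroup (spectralSubmodule Ω s))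

instance : Module ℝ (SpecHs Ω s) := inferInstanceAs (Module ℝ (spectralSubmodule Ω s))

/-- The inclusion `ℍ^s(Ω) ⊆ L²(Ω)`. -/
def toL2 : SpecHs Ω s →ₗ[ℝ] L2 Ω := (spectralSubmodule Ω s).subtype

/-- The inner product `(u, w) = ∑_n λ_n^s u_n w_n`, with the sum grouped by eigenvalues. -/
def innerSpec (u w : SpecHs Ω s) : ℝ :=
  ∑' lam : PosReal,
    (lam : ℝ) ^ (s : ℝ) * inner ℝ (eigenProj Ω lam (toL2 u)) (eigenProj Ω lam (toL2 w))

theorem summable_inner (u w : SpecHs Ω s) : Summable fun lam : PosReal =>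
    (lam : ℝ) ^ (s : ℝ) *
      (inner ℝ (eigenProj Ω lam (toL2 u)) (eigenProj Ω lam (toL2 w)) : ℝ) := by
  refine Summable.of_norm_bounded (u.2.2.add w.2.2) fun lam => ?_
  have h := Real.rpow_nonneg lam.2.le (s : ℝ)
  rw [norm_mul, Real.norm_of_nonneg h, ← mul_add]
  refine mul_le_mul_of_nonneg_left ?_ h
  have h1 := norm_inner_le_norm (𝕜 := ℝ) (eigenProj Ω lam (toL2 u)) (eigenProj Ω lam (toL2 w))
  refine h1.trans ?_
  change ‖eigenProj Ω lam (toL2 u)‖ * ‖eigenProj Ω lam (toL2 w)‖ ≤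
    ‖eigenProj Ω lam (toL2 u)‖ ^ 2 + ‖eigenProj Ω lam (toL2 w)‖ ^ 2
  nlinarith [sq_nonneg (‖eigenProj Ω lam (toL2 u)‖ - ‖eigenProj Ω lam (toL2 w)‖),
    sq_nonneg ‖eigenProj Ω lam (toL2 u)‖, sq_nonneg ‖eigenProj Ω lam (toL2 w)‖]

/-- The inner product space structure of `ℍ^s(Ω)`. -/
@[reducible] def core : InnerProductSpace.Core ℝ (SpecHs Ω s) where
  inner := innerSpec
  conj_inner_symm u w := by
    simp only [conj_trivial, innerSpec, real_inner_comm]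
  re_inner_nonneg u := by
    simp only [innerSpec, RCLike.re_to_real]
    exact tsum_nonneg fun lam => mul_nonneg (Real.rpow_nonneg lam.2.le _) real_inner_self_nonneg
  add_left u v w := by
    simp only [innerSpec]
    rw [← (summable_inner u w).tsum_add (summable_inner v w)]
    refine tsum_congr fun lam => ?_
    rw [map_add, map_add, inner_add_left]
    ring
  smul_left u w a := by
    simp only [innerSpec, conj_trivial]
    rw [← tsum_mul_left]
    refine tsum_congr fun lam => ?_
    rw [map_smul, map_smul, real_inner_smul_left]
    ring
  definite u hu := by
    have hnn : ∀ lam : PosReal, 0 ≤ (lam : ℝ) ^ (s : ℝ) *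
        (inner ℝ (eigenProj Ω lam (toL2 u)) (eigenProj Ω lam (toL2 u)) : ℝ) := fun lam =>
      mul_nonneg (Real.rpow_nonneg lam.2.le _) real_inner_self_nonneg
    have hsum := (summable_inner u u).hasSum
    have htsum : ∑' lam : PosReal, (lam : ℝ) ^ (s : ℝ) *
        (inner ℝ (eigenProj Ω lam (toL2 u)) (eigenProj Ω lam (toL2 u)) : ℝ) = 0 := hu
    rw [htsum] at hsum
    have h0 := (hasSum_zero_iff_of_nonneg hnn).1 hsum
    have hP : ∀ lam : PosReal, eigenProj Ω lam (toL2 u) = 0 := fun lam => by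
      have h1 := congrFun h0 lam
      simp only [Pi.zero_apply, mul_eq_zero] at h1
      rcases h1 with h1 | h1
      · exact absurd h1 (Real.rpow_pos_of_pos lam.2 _).ne'
      · exact inner_self_eq_zero.1 h1
    have hle : (⨆ lam : PosReal, dirichletEigenspace Ω lam) ≤
        (Submodule.span ℝ {toL2 u})ᗮ := by
      refine iSup_le fun lam v hv => ?_
      rw [Submodule.mem_orthogonal_singleton_iff_inner_right]
      have h2 : toL2 u ∈ (dirichletEigenspace Ω lam)ᗮ :=
        (Submodule.starProjection_apply_eq_zero_iff _).1 (hP lam)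
      rw [real_inner_comm]
      exact h2 v hv
    have hmem := Submodule.topologicalClosure_minimal _ hle
      (Submodule.isClosed_orthogonal _) u.2.1
    exact Subtype.ext (inner_self_eq_zero.1
      ((Submodule.mem_orthogonal_singleton_iff_inner_right (𝕜 := ℝ)).1 hmem))

instance : NormedAddCommGroup (SpecHs Ω s) := core.toNormedAddCommGroup

instance : InnerProductSpace ℝ (SpecHs Ω s) := InnerProductSpace.ofCore core.toCore

end SpecHs

/-! ### The minimization problem -/

/-- `F : W → ℝ` is (sequentially) weakly lower semicontinuous, bounded below by a continuous
affine function, and continuously Fréchet differentiable. -/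
structure IsAdmissible {W : Type} [NormedAddCommGroup W] [InnerProductSpace ℝ W] (F : W → ℝ) :
    Prop where
  weakly_lsc : ∀ (u : ℕ → W) (w : W),
    Tendsto (fun k => toWeakSpace ℝ W (u k)) atTop (𝓝 (toWeakSpace ℝ W w)) →
      (F w : EReal) ≤ liminf (fun k => (F (u k) : EReal)) atTop
  bounded_below : ∃ (g : W →L[ℝ] ℝ) (c : ℝ), ∀ w, g w + c ≤ F w
  contDiff : ContDiff ℝ 1 F

/-- `|t|^0` with the convention `0^0 = 0`. -/
def absPowZero (t : ℝ) : ℝ := if t = 0 then 0 else 1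

/-- The objective `F(w) + (α/2) ‖w‖_W² + β ∫_Ω |w|^0 dx`. Here `W` is a Hilbert space of functions
and `rep w : ℝ^d → ℝ` is the function (class) that `w` stands for. -/
def objective {d : ℕ} (Ω : Set (Eucl d)) {W : Type} [NormedAddCommGroup W]
    [InnerProductSpace ℝ W] (rep : W → Eucl d → ℝ) (F : W → ℝ) (α β : ℝ) (w : W) : ℝ :=
  F w + α / 2 * ‖w‖ ^ 2 + β * ∫ x in Ω, absPowZero (rep w x)

/-- The problem `min_{w ∈ W} F(w) + (α/2) ‖w‖_W² + β ∫_Ω |w|^0 dx` has a (global) solution. -/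
def HasSolution {d : ℕ} (Ω : Set (Eucl d)) {W : Type} [NormedAddCommGroup W]
    [InnerProductSpace ℝ W] (rep : W → Eucl d → ℝ) (F : W → ℝ) (α β : ℝ) : Prop :=
  ∃ w : W, ∀ v : W, objective Ω rep F α β w ≤ objective Ω rep F α β v

end FracSob

end

open FracSob

/-!
In all three spaces a bounded sequence which converges weakly converges in measure on `Ω`. This is
a Rellich argument for the mean oscillation `∫ ⨍_{|z| < h} |w(x + z) - w(x)| dz dx` over the
points of `Ω` at distance at least `h` from its complement: it is at most `ρ(h) ‖w‖_W` with
`ρ(h) → 0` as `h → 0`, whereas the averages over balls of a fixed radius converge pointwise under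
weak convergence. The measure of the support is lower semicontinuous under convergence in measure,
because the sets `{|w| ≥ 1/n}` exhaust the support, so `w ↦ ∫_Ω |w|^0` is weakly lower
semicontinuous. The objective is coercive, as `‖w‖²` beats the affine minorant of `F`, and the
direct method applies.

In the first two spaces the oscillation is bounded by the Gagliardo seminorm. In the spectral space
translations satisfy `‖w(· + z) - w‖ ≤ 3 |z|^s ‖w‖`, by splitting the eigenfunction expansion at
the eigenvalue `|z|⁻²`: below it the gradient controls the translation, above it the `L²` norm is
already small. A translation that moves `Ω` off itself gives the Poincaré inequality.
-/

noncomputable section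

namespace FracSob

/-! ### The direct method -/

section DirectMethod

variable {ι E W : Type*} [NormedAddCommGroup E] [NormedSpace ℝ E] [NormedAddCommGroup W]
  [InnerProductSpace ℝ W] {l : Filter ι}

theorem tendsto_toWeakSpace_iff_forall_dual {u : ι → E} {w : E} :
    Tendsto (fun i => toWeakSpace ℝ E (u i)) l (𝓝 (toWeakSpace ℝ E w)) ↔
      ∀ f : E →L[ℝ] ℝ, Tendsto (fun i => f (u i)) l (𝓝 (f w)) :=
  WeakBilin.tendsto_iff_forall_eval_tendsto (topDualPairing ℝ E).flip fun _ _ h =>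
    (SeparatingDual.eq_iff_forall_dual_eq (R := ℝ)).2 fun f => LinearMap.congr_fun h f

theorem tendsto_toWeakSpace_iff_forall_inner [CompleteSpace W] {u : ι → W} {w : W} :
    Tendsto (fun i => toWeakSpace ℝ W (u i)) l (𝓝 (toWeakSpace ℝ W w)) ↔
      ∀ v, Tendsto (fun i => inner ℝ v (u i)) l (𝓝 (inner ℝ v w)) :=
  tendsto_toWeakSpace_iff_forall_dual.trans (InnerProductSpace.toDual ℝ W).surjective.forall

theorem exists_tendsto_toWeakSpace_subseq [CompleteSpace W] {u : ℕ → W}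
    (hu : Bornology.IsBounded (Set.range u)) :
    ∃ (w : W) (φ : ℕ → ℕ), StrictMono φ ∧
      Tendsto (fun k => toWeakSpace ℝ W (u (φ k))) atTop (𝓝 (toWeakSpace ℝ W w)) := by
  obtain ⟨M, hM⟩ := isBounded_iff_forall_norm_le.1 hu
  set V : Submodule ℝ W := (Submodule.span ℝ (Set.range u)).topologicalClosure
  have : CompleteSpace V := (Submodule.isClosed_topologicalClosure _).completeSpace_coe
  have : TopologicalSpace.SeparableSpace V :=
    ((Set.countable_range u).isSeparable.span (R := ℝ)).closure.separableSpace
  let u' (k : ℕ) : V :=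
    ⟨u k, Submodule.le_topologicalClosure _ (Submodule.subset_span (Set.mem_range_self k))⟩
  obtain ⟨g, -, φ, hφ, hlim⟩ := WeakDual.isSeqCompact_closedBall ℝ V 0 M
    (x := fun k => StrongDual.toWeakDual (InnerProductSpace.toDual ℝ V (u' k))) fun k => by
      simpa [u'] using hM _ (Set.mem_range_self k)
  refine ⟨(InnerProductSpace.toDual ℝ V).symm (WeakDual.toStrongDual g), φ, hφ,
    tendsto_toWeakSpace_iff_forall_inner.2 fun v => ?_⟩
  have heval := ((WeakDual.eval_continuous (V.orthogonalProjectionOnto v)).tendsto g).comp hlim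
  have hinner : ∀ x : V, inner ℝ v (x : W) = inner ℝ x (V.orthogonalProjectionOnto v) := fun x => by
    rw [real_inner_comm, ← Submodule.inner_orthogonalProjectionOnto_eq_of_mem_left]
  simp only [hinner, InnerProductSpace.toDual_symm_apply]
  exact heval.congr fun k => (hinner (u' (φ k))).symm

/-- Sequential weak lower semicontinuity of a real function, with the limit inferior taken in
`EReal` since it may be infinite. -/
def IsWeaklySeqLSC (F : E → ℝ) : Prop :=
  ∀ (u : ℕ → E) (w : E),
    Tendsto (fun k => toWeakSpace ℝ E (u k)) atTop (𝓝 (toWeakSpace ℝ E w)) →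
      (F w : EReal) ≤ liminf (fun k => (F (u k) : EReal)) atTop

/-- Boundedness from below by a continuous affine function. -/
def HasAffineMinorant (F : E → ℝ) : Prop :=
  ∃ (g : E →L[ℝ] ℝ) (c : ℝ), ∀ w, g w + c ≤ F w

theorem isWeaklySeqLSC_norm_sq : IsWeaklySeqLSC fun w : W => ‖w‖ ^ 2 := by
  intro u w hu
  have htangent : Tendsto (fun k => 2 * inner ℝ w (u k) - ‖w‖ ^ 2) atTop (𝓝 (‖w‖ ^ 2)) := by
    have := ((tendsto_toWeakSpace_iff_forall_dual.1 hu (innerSL ℝ w)).const_mul 2).sub_const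
      (‖w‖ ^ 2)
    simpa only [innerSL_apply_apply, real_inner_self_eq_norm_sq, two_mul, add_sub_cancel_right]
      using this
  rw [← (EReal.tendsto_coe.2 htangent).liminf_eq]
  refine liminf_le_liminf (Eventually.of_forall fun k => EReal.coe_le_coe_iff.2 ?_)
  linarith [norm_sub_sq_real w (u k), sq_nonneg ‖w - u k‖]

theorem IsWeaklySeqLSC.add {F G : E → ℝ} (hF : IsWeaklySeqLSC F) (hG : IsWeaklySeqLSC G) :
    IsWeaklySeqLSC fun w => F w + G w := by
  intro u w hu
  simp only [EReal.coe_add]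
  exact (add_le_add (hF u w hu) (hG u w hu)).trans EReal.le_liminf_add

theorem IsWeaklySeqLSC.const_mul {F : E → ℝ} (hF : IsWeaklySeqLSC F) {a : ℝ} (ha : 0 ≤ a) :
    IsWeaklySeqLSC fun w => a * F w := by
  intro u w hu
  simp only [EReal.coe_mul]
  rw [EReal.liminf_const_mul_of_nonneg_of_ne_top (EReal.coe_nonneg.2 ha) (EReal.coe_ne_top a)]
  exact mul_le_mul_of_nonneg_left (hF u w hu) (EReal.coe_nonneg.2 ha)

theorem IsWeaklySeqLSC.exists_forall_le [CompleteSpace W] {J : W → ℝ} (hJ : IsWeaklySeqLSC J)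
    (hcoercive : Tendsto J (Bornology.cobounded W) atTop) : ∃ w, ∀ v, J w ≤ J v := by
  obtain ⟨a, ha_anti, ha_lim, ha_mem⟩ :=
    exists_seq_tendsto_sInf (Set.range_nonempty fun w => (J w : EReal)) (OrderBot.bddBelow _)
  choose u hu using ha_mem
  have hbdd : Bornology.IsBounded (Set.range u) := by
    have hsublevel : Bornology.IsBounded {w | J (u 0) < J w}ᶜ :=
      Bornology.isBounded_compl_iff.2 (hcoercive.eventually_gt_atTop (J (u 0)))
    refine hsublevel.subset (Set.range_subset_iff.2 fun k => Set.notMem_ofPred_iff.2 (not_lt.2 ?_))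
    exact EReal.coe_le_coe_iff.1 ((hu k).trans_le ((ha_anti k.zero_le).trans_eq (hu 0).symm))
  obtain ⟨w, φ, hφ, hw⟩ := exists_tendsto_toWeakSpace_subseq hbdd
  refine ⟨w, fun v => EReal.coe_le_coe_iff.1 ((hJ _ w hw).trans ?_)⟩
  simp only [hu]
  exact (ha_lim.comp hφ.tendsto_atTop).liminf_eq.trans_le (sInf_le (Set.mem_range_self v))

theorem HasAffineMinorant.tendsto_cobounded {F N : E → ℝ} (hF : HasAffineMinorant F) {α : ℝ}
    (hα : 0 < α) (hN : ∀ w, 0 ≤ N w) :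
    Tendsto (fun w => F w + α / 2 * ‖w‖ ^ 2 + N w) (Bornology.cobounded E) atTop := by
  obtain ⟨g, c, hg⟩ := hF
  have hlower : ∀ w, ‖w‖ * (α / 2 * ‖w‖ - ‖g‖) + c ≤ F w + α / 2 * ‖w‖ ^ 2 + N w := fun w => by
    linarith [hg w, neg_le_of_abs_le (g.le_opNorm w), hN w]
  refine tendsto_atTop_mono hlower (tendsto_atTop_add_const_right _ _ ?_)
  exact tendsto_norm_cobounded_atTop.atTop_mul_atTop₀ (tendsto_atTop_add_const_right _ (-‖g‖)
    (tendsto_norm_cobounded_atTop.const_mul_atTop (half_pos hα)))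

end DirectMethod

/-! ### Lower semicontinuity of the measure of the support -/

section MeasureSupport

variable {X ι E : Type*} [MeasurableSpace X] {μ : Measure X} [NormedAddCommGroup E]

theorem measure_support_le_liminf {l : Filter ι} {f : ι → X → E} {g : X → E}
    (h : TendstoInMeasure μ f l g) :
    μ (Function.support g) ≤ liminf (fun i => μ (Function.support (f i))) l := by
  let A (n : ℕ) : Set X := {x | ((n : ℝ≥0∞) + 1)⁻¹ ≤ ‖g x‖ₑ}
  have hA_mono : Monotone A := fun m n hmn x hx =>
    le_trans (ENNReal.inv_le_inv.2 (by gcongr)) hx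
  have hsupport : Function.support g ⊆ ⋃ n, A n := fun x hx => by
    obtain ⟨n, hn⟩ := ENNReal.exists_inv_nat_lt (enorm_ne_zero.2 hx)
    exact Set.mem_iUnion.2 ⟨n, (ENNReal.inv_le_inv.2 le_self_add).trans hn.le⟩
  refine (measure_mono hsupport).trans ?_
  rw [hA_mono.measure_iUnion]
  refine iSup_le fun n => ?_
  have hε : (0 : ℝ≥0∞) < ((n : ℝ≥0∞) + 1)⁻¹ := ENNReal.inv_pos.2 (by finiteness)
  rw [← ENNReal.liminf_add_of_right_tendsto_zero (h _ hε)]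
  refine le_liminf_of_le (by isBoundedDefault) (Eventually.of_forall fun i => ?_)
  refine (measure_mono fun x hx => ?_).trans (measure_union_le _ _)
  by_cases hfi : f i x = 0
  · refine Or.inr ?_
    rw [Set.mem_ofPred_eq, hfi, edist_zero_left]
    exact hx
  · exact Or.inl hfi

theorem isWeaklySeqLSC_measureReal_support {W : Type*} [NormedAddCommGroup W] [NormedSpace ℝ W]
    [IsFiniteMeasure μ] {rep : W → X → E}
    (hrep : ∀ (u : ℕ → W) (w : W),
      Tendsto (fun k => toWeakSpace ℝ W (u k)) atTop (𝓝 (toWeakSpace ℝ W w)) →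
        TendstoInMeasure μ (fun k => rep (u k)) atTop (rep w)) :
    IsWeaklySeqLSC fun w => μ.real (Function.support (rep w)) := by
  intro u w hu
  have hcoe : ∀ v, (μ.real (Function.support (rep v)) : EReal) =
      (μ (Function.support (rep v)) : EReal) := fun v =>
    EReal.coe_ennreal_toReal (measure_ne_top _ _)
  simp only [hcoe]
  have hliminf := EReal.coe_ennreal_strictMono.monotone.map_liminf_of_continuousAt
    (F := atTop) (fun k => μ (Function.support (rep (u k))))
    continuous_coe_ennreal_ereal.continuousAt
  exact (EReal.coe_ennreal_le_coe_ennreal_iff.2 (measure_support_le_liminf (hrep u w hu))).trans_eq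
    hliminf

end MeasureSupport

theorem integral_absPowZero {X : Type*} [MeasurableSpace X] {μ : Measure X} {f : X → ℝ}
    (hf : NullMeasurableSet (Function.support f) μ) :
    ∫ x, absPowZero (f x) ∂μ = μ.real (Function.support f) := by
  have hindicator : (fun x => absPowZero (f x)) = (Function.support f).indicator 1 := by
    ext x
    simp [absPowZero, Set.indicator, ite_not]
  rw [hindicator, integral_indicator₀ hf]
  simp

/-! ### Convergence in measure from small mean oscillation -/

section MeanOscillation

variable {X ι E : Type*}

theorem tendstoInMeasure_zero_of_forall_approx [MeasurableSpace X] {μ : Measure X}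
    [NormedAddCommGroup E] {l : Filter ι} {f : ι → X → E}
    (h : ∀ η : ℝ≥0∞, η ≠ 0 → ∃ (K : Set X) (g : ι → X → E), μ Kᶜ ≤ η ∧
      TendstoInMeasure (μ.restrict K) g l 0 ∧
      (∀ i, AEMeasurable (fun x => ‖f i x - g i x‖ₑ) (μ.restrict K)) ∧
      ∀ i, ∫⁻ x in K, ‖f i x - g i x‖ₑ ∂μ ≤ η) :
    TendstoInMeasure μ f l 0 := by
  rw [tendstoInMeasure_iff_enorm]
  intro ε hε hε_top
  rw [ENNReal.tendsto_nhds_zero]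
  intro δ hδ
  have hε2 : ε / 2 ≠ 0 := (ENNReal.half_pos hε.ne').ne'
  have hε2_top : ε / 2 ≠ ⊤ := ENNReal.div_ne_top hε_top two_ne_zero
  have hδ3 : δ / 3 ≠ 0 := (ENNReal.div_pos hδ.ne' ENNReal.ofNat_ne_top).ne'
  obtain ⟨K, g, hK, hg, hm, hfg⟩ := h (min (δ / 3) (δ / 3 * (ε / 2)))
    (lt_min hδ3.bot_lt (mul_ne_zero hδ3 hε2).bot_lt).ne'
  rw [tendstoInMeasure_iff_enorm] at hg
  filter_upwards [ENNReal.tendsto_nhds_zero.1 (hg (ε / 2) hε2.bot_lt hε2_top) (δ / 3)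
    hδ3.bot_lt] with i hgi
  simp only [Pi.zero_apply, sub_zero] at hgi ⊢
  have hmarkov : μ.restrict K {x | ε / 2 ≤ ‖f i x - g i x‖ₑ} ≤ δ / 3 :=
    (meas_ge_le_lintegral_div (hm i) hε2 hε2_top).trans
      (ENNReal.div_le_of_le_mul ((hfg i).trans (min_le_right _ _)))
  have hsplit : μ.restrict K {x | ε ≤ ‖f i x‖ₑ} ≤ δ / 3 + δ / 3 := by
    refine (measure_mono fun x hx => ?_).trans
      ((measure_union_le _ _).trans (add_le_add hmarkov hgi))
    by_contra! hcon
    simp only [Set.mem_union, Set.mem_ofPred_eq, not_or, not_le] at hcon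
    have hlt := ENNReal.add_lt_add hcon.1 hcon.2
    rw [ENNReal.add_halves] at hlt
    exact hlt.not_ge (hx.trans (by simpa using enorm_add_le (f i x - g i x) (g i x)))
  calc μ {x | ε ≤ ‖f i x‖ₑ}
      ≤ μ ({x | ε ≤ ‖f i x‖ₑ} ∩ K) + μ ({x | ε ≤ ‖f i x‖ₑ} \ K) := measure_le_inter_add_sdiff _ _ _
    _ ≤ δ / 3 + δ / 3 + δ / 3 := by
      gcongr
      · exact (Measure.le_restrict_apply _ _).trans hsplit
      · exact (measure_mono (Set.sdiff_subset_compl _ _)).trans (hK.trans (min_le_left _ _))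
    _ = δ := ENNReal.add_thirds δ

theorem enorm_sub_average_le [MeasurableSpace X] {μ : Measure X} [IsFiniteMeasure μ] [NeZero μ]
    [NormedAddCommGroup E] [NormedSpace ℝ E] [CompleteSpace E] {f : X → E}
    (hf : Integrable f μ) (c : E) : ‖c - ⨍ x, f x ∂μ‖ₑ ≤ ⨍⁻ x, ‖c - f x‖ₑ ∂μ := by
  have haverage : c - ⨍ x, f x ∂μ = ⨍ x, (c - f x) ∂μ := by
    rw [average, average, integral_sub (integrable_const c) hf.to_average, integral_const,
      probReal_univ, one_smul]
  rw [haverage]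
  exact enorm_integral_le_lintegral_enorm _

variable [PseudoMetricSpace X]

/-- The erosion of a set by the radius `h`: the centers of the balls of radius `h` that lie in
the set. -/
def erosion (h : ℝ) (Ω : Set X) : Set X := {x | Metric.ball x h ⊆ Ω}

theorem erosion_eq_compl_thickening (h : ℝ) (Ω : Set X) :
    erosion h Ω = (Metric.thickening h Ωᶜ)ᶜ := by
  ext x
  simp only [erosion, Set.mem_ofPred_eq, Set.mem_compl_iff, Metric.mem_thickening_iff, not_exists,
    not_and', not_not, Set.subset_def, Metric.mem_ball']

theorem erosion_subset {h : ℝ} (hh : 0 < h) (Ω : Set X) : erosion h Ω ⊆ Ω :=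
  fun _ hx => hx (Metric.mem_ball_self hh)

variable [MeasurableSpace X] [BorelSpace X] {μ : Measure X}

theorem measurableSet_erosion (h : ℝ) (Ω : Set X) : MeasurableSet (erosion h Ω) := by
  rw [erosion_eq_compl_thickening]
  exact Metric.isOpen_thickening.measurableSet.compl

theorem tendsto_measure_sdiff_erosion {Ω : Set X} (hΩ : IsOpen Ω)
    (hμ : μ Ω ≠ ⊤) : Tendsto (fun h => μ (Ω \ erosion h Ω)) (𝓝[>] 0) (𝓝 0) := by
  have : IsFiniteMeasure (μ.restrict Ω) := ⟨by simpa using hμ.lt_top⟩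
  have hlim := tendsto_measure_thickening_of_isClosed (μ := μ.restrict Ω)
    ⟨1, one_pos, measure_ne_top _ _⟩ hΩ.isClosed_compl
  rw [Measure.restrict_apply hΩ.isClosed_compl.measurableSet, Set.compl_inter_self,
    measure_empty] at hlim
  refine hlim.congr fun h => ?_
  rw [Measure.restrict_apply Metric.isOpen_thickening.measurableSet, Set.inter_comm,
    erosion_eq_compl_thickening, Set.sdiff_compl]

variable [NormedAddCommGroup E]

/-- The integral over the points of the erosion of `Ω` by `h` of the mean distance of the value of
`f` at the point from its values in the ball of radius `h` around it. -/
def meanOscillation (μ : Measure X) (Ω : Set X) (h : ℝ) (f : X → E) : ℝ≥0∞ :=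
  ∫⁻ x in erosion h Ω, ⨍⁻ y in Metric.ball x h, ‖f x - f y‖ₑ ∂μ ∂μ

theorem lintegral_enorm_sub_setAverage_le_meanOscillation
    [NormedSpace ℝ E] [CompleteSpace E] [μ.IsOpenPosMeasure] {Ω : Set X} (hμ : μ Ω ≠ ⊤) {f : X → E}
    (hf : IntegrableOn f Ω μ) {h : ℝ} (hh : 0 < h) :
    ∫⁻ x in erosion h Ω, ‖f x - ⨍ y in Metric.ball x h, f y ∂μ‖ₑ ∂μ ≤
      meanOscillation μ Ω h f := by
  refine setLIntegral_mono' (measurableSet_erosion h Ω) fun x hx => ?_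
  have : IsFiniteMeasure (μ.restrict (Metric.ball x h)) :=
    ⟨by simpa using (measure_mono hx).trans_lt hμ.lt_top⟩
  have : NeZero (μ.restrict (Metric.ball x h)) :=
    ⟨by simpa using (Metric.measure_ball_pos μ x hh).ne'⟩
  exact enorm_sub_average_le (hf.mono_set hx) (f x)

variable [SecondCountableTopology X] [SFinite μ]

theorem measurableSet_dist_lt (h : ℝ) : MeasurableSet {z : X × X | dist z.2 z.1 < h} :=
  measurableSet_lt (measurable_snd.dist measurable_fst) measurable_const

theorem measurable_lintegral_ball {g : X × X → ℝ≥0∞} (hg : Measurable g) (h : ℝ) :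
    Measurable fun x => ∫⁻ y in Metric.ball x h, g (x, y) ∂μ := by
  have := (hg.indicator (measurableSet_dist_lt h)).lintegral_prod_right' (ν := μ)
  convert this using 2 with x
  rw [← lintegral_indicator Metric.isOpen_ball.measurableSet]
  rfl

theorem measurable_measure_ball (h : ℝ) : Measurable fun x : X => μ (Metric.ball x h) := by
  simpa using measurable_lintegral_ball (μ := μ) (g := fun _ : X × X => 1) measurable_const h

variable [NormedSpace ℝ E]

theorem stronglyMeasurable_setAverage_ball {f : X → E} (hf : StronglyMeasurable f) (h : ℝ) :
    StronglyMeasurable fun x => ⨍ y in Metric.ball x h, f y ∂μ := by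
  have hintegral : StronglyMeasurable fun x => ∫ y in Metric.ball x h, f y ∂μ := by
    have := ((hf.comp_measurable measurable_snd).indicator
      (measurableSet_dist_lt h)).integral_prod_right' (ν := μ)
    convert this using 2 with x
    rw [← integral_indicator Metric.isOpen_ball.measurableSet]
    rfl
  simp only [setAverage_eq]
  exact (measurable_measure_ball h).ennreal_toReal.inv.stronglyMeasurable.smul hintegral

theorem tendstoInMeasure_zero_of_meanOscillation [CompleteSpace E] [μ.IsOpenPosMeasure]
    {Ω : Set X} (hΩ : IsOpen Ω) (hμ : μ Ω ≠ ⊤) {f : ℕ → X → E}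
    (hm : ∀ k, StronglyMeasurable (f k)) (hi : ∀ k, IntegrableOn (f k) Ω μ)
    (haverage : ∀ x h, Metric.ball x h ⊆ Ω →
      Tendsto (fun k => ⨍ y in Metric.ball x h, f k y ∂μ) atTop (𝓝 0))
    (hosc : Tendsto (fun h => ⨆ k, meanOscillation μ Ω h (f k)) (𝓝[>] 0) (𝓝 0)) :
    TendstoInMeasure (μ.restrict Ω) f atTop 0 := by
  refine tendstoInMeasure_zero_of_forall_approx fun η hη => ?_
  obtain ⟨h, hsdiff, hoscη, hh⟩ :=
    ((ENNReal.tendsto_nhds_zero.1 (tendsto_measure_sdiff_erosion hΩ hμ) η hη.bot_lt).and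
      ((ENNReal.tendsto_nhds_zero.1 hosc η hη.bot_lt).and self_mem_nhdsWithin)).exists
  have hrestrict : (μ.restrict Ω).restrict (erosion h Ω) = μ.restrict (erosion h Ω) := by
    rw [Measure.restrict_restrict_of_subset (erosion_subset hh Ω)]
  have : IsFiniteMeasure (μ.restrict (erosion h Ω)) :=
    ⟨by simpa using (measure_mono (erosion_subset hh Ω)).trans_lt hμ.lt_top⟩
  refine ⟨erosion h Ω, fun k x => ⨍ y in Metric.ball x h, f k y ∂μ, ?_, ?_, fun k => ?_,
    fun k => ?_⟩
  · rwa [Measure.restrict_apply (measurableSet_erosion h Ω).compl, Set.inter_comm,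
      ← Set.sdiff_eq]
  · rw [hrestrict]
    refine tendstoInMeasure_of_tendsto_ae
      (fun k => (stronglyMeasurable_setAverage_ball (hm k) h).aestronglyMeasurable) ?_
    filter_upwards [ae_restrict_mem (measurableSet_erosion h Ω)] with x hx
    exact haverage x h hx
  · exact ((hm k).sub (stronglyMeasurable_setAverage_ball (hm k) h)).enorm.aemeasurable
  · rw [hrestrict]
    exact (lintegral_enorm_sub_setAverage_le_meanOscillation hμ (hi k) hh).trans
      ((le_iSup (fun k => meanOscillation μ Ω h (f k)) k).trans hoscη)

end MeanOscillation

/-! ### Bounds for the mean oscillation -/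

section MeanOscillationBounds

section Metric

variable {X E : Type*} [PseudoMetricSpace X] [MeasurableSpace X] [BorelSpace X] {μ : Measure X}

theorem meanOscillation_congr_ae [NormedAddCommGroup E] {Ω : Set X} {f g : X → E}
    (hfg : f =ᵐ[μ.restrict Ω] g) {h : ℝ} (hh : 0 < h) :
    meanOscillation μ Ω h f = meanOscillation μ Ω h g := by
  refine lintegral_congr_ae ?_
  filter_upwards [ae_restrict_mem (measurableSet_erosion h Ω),
    ae_restrict_of_ae_restrict_of_subset (erosion_subset hh Ω) hfg] with x hx hfgx
  rw [laverage_eq, laverage_eq]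
  congr 1
  refine lintegral_congr_ae ?_
  filter_upwards [ae_restrict_of_ae_restrict_of_subset hx hfg] with y hfgy
  rw [hfgx, hfgy]

theorem setLIntegral_erosion_ball [SecondCountableTopology X] [SFinite μ] {g : X × X → ℝ≥0∞}
    (hg : Measurable g) (Ω : Set X) (h : ℝ) :
    ∫⁻ x in erosion h Ω, ∫⁻ y in Metric.ball x h, g (x, y) ∂μ ∂μ =
      ∫⁻ z in {z | z.1 ∈ erosion h Ω ∧ dist z.2 z.1 < h}, g z ∂(μ.prod μ) := by
  have hP : MeasurableSet {z : X × X | z.1 ∈ erosion h Ω ∧ dist z.2 z.1 < h} :=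
    (measurable_fst (measurableSet_erosion h Ω)).inter (measurableSet_dist_lt h)
  rw [← lintegral_indicator hP, lintegral_prod _ (hg.indicator hP).aemeasurable,
    ← lintegral_indicator (measurableSet_erosion h Ω)]
  refine lintegral_congr fun x => ?_
  by_cases hx : x ∈ erosion h Ω
  · rw [Set.indicator_of_mem hx, ← lintegral_indicator Metric.isOpen_ball.measurableSet]
    refine lintegral_congr fun y => ?_
    simp only [Set.indicator, Metric.mem_ball, Set.mem_ofPred_eq, hx, true_and]
  · simp only [Set.indicator, Set.mem_ofPred_eq, hx, false_and, if_false, lintegral_zero]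

end Metric

section Haar

variable {V E : Type*} [NormedAddCommGroup V] [MeasurableSpace V] [BorelSpace V]
  {μ : Measure V} [NormedAddCommGroup E]

theorem setLAverage_ball_eq_setLAverage_ball_zero [μ.IsAddHaarMeasure] (g : V → ℝ≥0∞) (x : V)
    (h : ℝ) : ⨍⁻ y in Metric.ball x h, g y ∂μ = ⨍⁻ z in Metric.ball 0 h, g (x + z) ∂μ := by
  have hpreimage : (x + ·) ⁻¹' Metric.ball x h = Metric.ball 0 h := by
    rw [preimage_add_ball, sub_self]
  rw [setLAverage_eq, setLAverage_eq, Measure.addHaar_ball_center μ x h, ← hpreimage,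
    (measurePreserving_add_left μ x).setLIntegral_comp_preimage_emb
      (MeasurableEquiv.addLeft x).measurableEmbedding]

theorem meanOscillation_le_of_translation [SecondCountableTopology V] [SFinite μ]
    [μ.IsAddHaarMeasure] {Ω : Set V} {f : V → E}
    (hf : StronglyMeasurable f) {h : ℝ} (hh : 0 < h) {η : ℝ≥0∞}
    (hη : ∀ z ∈ Metric.ball (0 : V) h, ∫⁻ x in Ω, ‖f (x + z) - f x‖ₑ ∂μ ≤ η) :
    meanOscillation μ Ω h f ≤ η := by
  have hmeas : Measurable fun p : V × V => ‖f (p.1 + p.2) - f p.1‖ₑ :=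
    ((hf.comp_measurable (measurable_fst.add measurable_snd)).sub
      (hf.comp_measurable measurable_fst)).enorm
  calc meanOscillation μ Ω h f
      = ∫⁻ x in erosion h Ω, ⨍⁻ z in Metric.ball 0 h, ‖f (x + z) - f x‖ₑ ∂μ ∂μ := by
        refine lintegral_congr fun x => ?_
        rw [setLAverage_ball_eq_setLAverage_ball_zero]
        simp only [enorm_sub_rev (f x)]
    _ ≤ ∫⁻ x in Ω, ⨍⁻ z in Metric.ball 0 h, ‖f (x + z) - f x‖ₑ ∂μ ∂μ :=
        lintegral_mono_set (erosion_subset hh Ω)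
    _ = ⨍⁻ z in Metric.ball 0 h, ∫⁻ x in Ω, ‖f (x + z) - f x‖ₑ ∂μ ∂μ :=
        lintegral_lintegral_swap hmeas.aemeasurable
    _ ≤ ⨍⁻ _ in Metric.ball (0 : V) h, η ∂μ := by
        rw [setLAverage_eq, setLAverage_eq]
        gcongr 1
        exact setLIntegral_mono measurable_const hη
    _ ≤ η := by
        rw [setLAverage_eq, setLIntegral_const, mul_div_assoc]
        exact mul_le_of_le_one_right' ENNReal.div_self_le_one

theorem meanOscillation_eq_setLIntegral [SecondCountableTopology V] [SFinite μ]
    [μ.IsAddHaarMeasure] {f : V → E} (hf : StronglyMeasurable f) (Ω : Set V) (h : ℝ) :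
    meanOscillation μ Ω h f = (μ (Metric.ball 0 h))⁻¹ *
      ∫⁻ z in {z | z.1 ∈ erosion h Ω ∧ dist z.2 z.1 < h}, ‖f z.1 - f z.2‖ₑ ∂(μ.prod μ) := by
  have hmeas : Measurable fun z : V × V => ‖f z.1 - f z.2‖ₑ :=
    ((hf.comp_measurable measurable_fst).sub (hf.comp_measurable measurable_snd)).enorm
  rw [← setLIntegral_erosion_ball hmeas,
    ← lintegral_const_mul _ (measurable_lintegral_ball hmeas h)]
  refine lintegral_congr fun x => ?_
  rw [setLAverage_eq, Measure.addHaar_ball_center, ENNReal.div_eq_inv_mul]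

theorem measure_erosion_ball_le [SecondCountableTopology V] [SFinite μ] [μ.IsAddHaarMeasure]
    (Ω : Set V) {h : ℝ} (hh : 0 < h) :
    (μ.prod μ) {z | z.1 ∈ erosion h Ω ∧ dist z.2 z.1 < h} ≤ μ Ω * μ (Metric.ball 0 h) := by
  have hfubini := setLIntegral_erosion_ball (μ := μ) (g := 1) measurable_one Ω h
  simp only [Pi.one_apply, setLIntegral_one, Measure.addHaar_ball_center, setLIntegral_const]
    at hfubini
  rw [← hfubini, mul_comm]
  gcongr
  exact erosion_subset hh Ω

end Haar

variable {d : ℕ}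

theorem measurable_diffQuotient {w : Eucl d → ℝ} (hw : Measurable w) (s : ℝ) :
    Measurable (diffQuotient s w) := by
  unfold diffQuotient
  fun_prop

theorem enorm_sub_le_rpow_mul_enorm_diffQuotient {s : ℝ} (hs : 0 ≤ s) (w : Eucl d → ℝ) {h : ℝ}
    {x y : Eucl d} (hxy : dist y x < h) :
    ‖w x - w y‖ₑ ≤ ENNReal.ofReal (h ^ ((d : ℝ) / 2 + s)) * ‖diffQuotient s w (x, y)‖ₑ := by
  rcases eq_or_ne x y with rfl | hne
  · simp
  have hpos : 0 < ‖x - y‖ := norm_pos_iff.2 (sub_ne_zero.2 hne)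
  have hfactor : w x - w y = ‖x - y‖ ^ ((d : ℝ) / 2 + s) * diffQuotient s w (x, y) := by
    rw [diffQuotient]
    field_simp
  rw [hfactor, enorm_mul, Real.enorm_of_nonneg (by positivity)]
  rw [dist_comm, dist_eq_norm] at hxy
  gcongr

theorem setLIntegral_diffQuotient_le {s : ℝ} {w : Eucl d → ℝ} (hw : Measurable w)
    (Ω : Set (Eucl d)) {h : ℝ} (hh : 0 < h) :
    ∫⁻ z in {z | z.1 ∈ erosion h Ω ∧ dist z.2 z.1 < h}, ‖diffQuotient s w z‖ₑ ≤
      eLpNorm (diffQuotient s w) 2 (prodVolume Ω) *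
        (volume Ω * volume (Metric.ball (0 : Eucl d) h)) ^ (1 / 2 : ℝ) := by
  rw [← eLpNorm_one_eq_lintegral_enorm]
  refine (eLpNorm_le_eLpNorm_mul_rpow_measure_univ one_le_two
    (measurable_diffQuotient hw s).aestronglyMeasurable).trans ?_
  rw [Measure.restrict_apply_univ,
    show 1 / (1 : ℝ≥0∞).toReal - 1 / (2 : ℝ≥0∞).toReal = 1 / 2 by norm_num]
  gcongr
  · rw [prodVolume, Measure.prod_restrict]
    refine Measure.restrict_mono (s' := Ω ×ˢ Ω) (fun z hz => ?_) le_rfl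
    exact ⟨erosion_subset hh Ω hz.1, hz.1 hz.2⟩
  · exact measure_erosion_ball_le Ω hh

theorem measure_div_ball_rpow_mul (a : ℝ≥0∞) {h : ℝ} (hh : 0 < h) :
    (a / volume (Metric.ball (0 : Eucl d) h)) ^ (1 / 2 : ℝ) * ENNReal.ofReal (h ^ ((d : ℝ) / 2)) =
      (a / volume (Metric.ball (0 : Eucl d) 1)) ^ (1 / 2 : ℝ) := by
  have hsqrt : ENNReal.ofReal (h ^ ((d : ℝ) / 2)) = ENNReal.ofReal (h ^ d) ^ (1 / 2 : ℝ) := by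
    rw [ENNReal.ofReal_rpow_of_nonneg (by positivity) (by positivity),
      ← Real.rpow_natCast_mul hh.le]
    ring_nf
  have hpow : ENNReal.ofReal (h ^ d) ≠ 0 := by simpa using pow_pos hh d
  rw [hsqrt, ← ENNReal.mul_rpow_of_nonneg _ _ (by positivity),
    Measure.addHaar_ball_of_pos volume (0 : Eucl d) hh, finrank_euclideanSpace_fin]
  congr 1
  rw [mul_comm, ← mul_div_assoc, ENNReal.mul_div_mul_left _ _ hpow ENNReal.ofReal_ne_top]

theorem meanOscillation_le_diffQuotient {s : ℝ} (hs : 0 ≤ s) {w : Eucl d → ℝ} (hw : Measurable w)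
    (Ω : Set (Eucl d)) {h : ℝ} (hh : 0 < h) :
    meanOscillation volume Ω h w ≤
      (volume Ω / volume (Metric.ball (0 : Eucl d) 1)) ^ (1 / 2 : ℝ) * ENNReal.ofReal (h ^ s) *
        eLpNorm (diffQuotient s w) 2 (prodVolume Ω) := by
  set b := volume (Metric.ball (0 : Eucl d) h)
  set Q := eLpNorm (diffQuotient s w) 2 (prodVolume Ω)
  set P : Set (Eucl d × Eucl d) := {z | z.1 ∈ erosion h Ω ∧ dist z.2 z.1 < h}
  have hb0 : b ≠ 0 := (Metric.measure_ball_pos _ _ hh).ne'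
  have hb_top : b ≠ ⊤ := measure_ball_lt_top.ne
  have hP : MeasurableSet P :=
    (measurable_fst (measurableSet_erosion h Ω)).inter (measurableSet_dist_lt h)
  have hsqrt : b⁻¹ * (volume Ω * b) ^ (1 / 2 : ℝ) = (volume Ω / b) ^ (1 / 2 : ℝ) := by
    rw [ENNReal.div_rpow_of_nonneg _ _ (by positivity),
      ENNReal.mul_rpow_of_nonneg _ _ (by positivity),
      ENNReal.div_eq_inv_mul, mul_left_comm, mul_comm (b ^ _)⁻¹, ← ENNReal.rpow_neg,
      ← ENNReal.rpow_neg_one, ← ENNReal.rpow_add _ _ hb0 hb_top]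
    norm_num
  calc meanOscillation volume Ω h w
      = b⁻¹ * ∫⁻ z in P, ‖w z.1 - w z.2‖ₑ :=
        meanOscillation_eq_setLIntegral hw.stronglyMeasurable Ω h
    _ ≤ b⁻¹ * ∫⁻ z in P, ENNReal.ofReal (h ^ ((d : ℝ) / 2 + s)) * ‖diffQuotient s w z‖ₑ := by
        gcongr 1
        exact setLIntegral_mono' hP fun z hz =>
          enorm_sub_le_rpow_mul_enorm_diffQuotient hs w hz.2
    _ ≤ b⁻¹ * (ENNReal.ofReal (h ^ ((d : ℝ) / 2 + s)) * (Q * (volume Ω * b) ^ (1 / 2 : ℝ))) := by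
        rw [lintegral_const_mul _ (measurable_diffQuotient hw s).enorm]
        gcongr
        exact setLIntegral_diffQuotient_le hw Ω hh
    _ = (b⁻¹ * (volume Ω * b) ^ (1 / 2 : ℝ)) * ENNReal.ofReal (h ^ ((d : ℝ) / 2)) *
          ENNReal.ofReal (h ^ s) * Q := by
        rw [Real.rpow_add hh, ENNReal.ofReal_mul (by positivity)]
        ring
    _ = _ := by rw [hsqrt, measure_div_ball_rpow_mul _ hh]

end MeanOscillationBounds

/-! ### Existence of minimizers from mean oscillation bounds -/

section Existence

theorem isBounded_range_of_tendsto_toWeakSpace {E : Type*} [NormedAddCommGroup E]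
    [NormedSpace ℝ E] {u : ℕ → E} {w : E}
    (hu : Tendsto (fun k => toWeakSpace ℝ E (u k)) atTop (𝓝 (toWeakSpace ℝ E w))) :
    Bornology.IsBounded (Set.range u) := by
  have hpointwise : ∀ f : StrongDual ℝ E,
      ∃ C, ∀ k, ‖NormedSpace.inclusionInDoubleDual ℝ E (u k) f‖ ≤ C := fun f => by
    obtain ⟨C, hC⟩ := isBounded_iff_forall_norm_le.1
      (Metric.isBounded_range_of_tendsto _ (tendsto_toWeakSpace_iff_forall_dual.1 hu f))
    exact ⟨C, fun k => hC _ ⟨k, rfl⟩⟩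
  obtain ⟨C, hC⟩ := banach_steinhaus hpointwise
  refine isBounded_iff_forall_norm_le.2 ⟨C, Set.forall_mem_range.2 fun k => ?_⟩
  rw [← (NormedSpace.inclusionInDoubleDualLi ℝ).norm_map (u k)]
  exact hC k

variable {d : ℕ} {Ω D : Set (Eucl d)}

theorem integrableOn_L2 (hΩD : Ω ⊆ D) (hΩ : volume Ω ≠ ⊤) (f : L2 D) : IntegrableOn f Ω := by
  have : IsFiniteMeasure (volume.restrict Ω) := ⟨by simpa using hΩ.lt_top⟩
  exact ((Lp.memLp f).mono_measure (Measure.restrict_mono hΩD le_rfl)).integrable one_le_two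

theorem setIntegral_eq_inner {A : Set (Eucl d)} (hA : MeasurableSet A)
    (hAD : A ⊆ D) (hμA : volume.restrict D A ≠ ⊤) (f : L2 D) :
    ∫ x in A, f x = inner ℝ (indicatorConstLp 2 hA hμA (1 : ℝ)) f := by
  rw [L2.inner_indicatorConstLp_one, Measure.restrict_restrict hA, Set.inter_eq_left.2 hAD]

theorem tendstoInMeasure_of_meanOscillation_le {W : Type*} [NormedAddCommGroup W]
    [NormedSpace ℝ W] (hΩ : IsOpen Ω) (hΩD : Ω ⊆ D) (hμ : volume Ω ≠ ⊤) (T : W →L[ℝ] L2 D)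
    {ρ : ℝ → ℝ≥0∞} (hρ : Tendsto ρ (𝓝[>] 0) (𝓝 0))
    (hosc : ∀ h > 0, ∀ w, meanOscillation volume Ω h (T w) ≤ ρ h * ‖w‖ₑ) {u : ℕ → W} {w : W}
    (hu : Tendsto (fun k => toWeakSpace ℝ W (u k)) atTop (𝓝 (toWeakSpace ℝ W w))) :
    TendstoInMeasure (volume.restrict Ω) (fun k => T (u k)) atTop (T w) := by
  obtain ⟨M, hM⟩ := isBounded_iff_forall_norm_le.1 (isBounded_range_of_tendsto_toWeakSpace hu)
  rw [Set.forall_mem_range] at hM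
  have hdiff : TendstoInMeasure (volume.restrict Ω) (fun k => T (u k - w)) atTop 0 := by
    refine tendstoInMeasure_zero_of_meanOscillation hΩ hμ (fun k => Lp.stronglyMeasurable _)
      (fun k => integrableOn_L2 hΩD hμ _) (fun x h hx => ?_) ?_
    · have hball : volume.restrict D (Metric.ball x h) ≠ ⊤ :=
        ((Measure.restrict_apply_le _ _).trans_lt measure_ball_lt_top).ne
      simp only [setAverage_eq,
        setIntegral_eq_inner Metric.isOpen_ball.measurableSet (hx.trans hΩD) hball]
      have hlim := (tendsto_toWeakSpace_iff_forall_dual.1 hu (innerSL ℝ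
        (indicatorConstLp 2 Metric.isOpen_ball.measurableSet hball (1 : ℝ)) ∘L T)).sub_const
        (inner ℝ (indicatorConstLp 2 Metric.isOpen_ball.measurableSet hball (1 : ℝ)) (T w))
      simpa [inner_sub_right] using hlim.const_smul (volume.real (Metric.ball x h))⁻¹
    · have hbound : Tendsto (fun h => ρ h * ENNReal.ofReal (M + ‖w‖)) (𝓝[>] 0) (𝓝 0) := by
        simpa using ENNReal.Tendsto.mul_const hρ (.inr ENNReal.ofReal_ne_top)
      refine tendsto_of_tendsto_of_tendsto_of_le_of_le' tendsto_const_nhds hbound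
        (Eventually.of_forall fun _ => zero_le) ?_
      filter_upwards [self_mem_nhdsWithin] with h hh
      refine iSup_le fun k => (hosc h hh _).trans ?_
      rw [← ofReal_norm]
      gcongr
      exact (norm_sub_le _ _).trans (by gcongr; exact hM k)
  have hcoe : TendstoInMeasure (volume.restrict Ω) (fun k x => T (u k) x - T w x) atTop 0 := by
    refine hdiff.congr_left fun k => ?_
    rw [map_sub]
    exact ae_restrict_of_ae_restrict_of_subset hΩD (Lp.coeFn_sub _ _)
  rw [tendstoInMeasure_iff_enorm] at hcoe ⊢
  simpa only [Pi.zero_apply, sub_zero] using hcoe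

theorem hasSolution_of_meanOscillation_le {W : Type} [NormedAddCommGroup W]
    [InnerProductSpace ℝ W] [CompleteSpace W] (hΩ : IsOpen Ω) (hΩD : Ω ⊆ D) (hμ : volume Ω ≠ ⊤)
    (T : W →L[ℝ] L2 D) {ρ : ℝ → ℝ≥0∞} (hρ : Tendsto ρ (𝓝[>] 0) (𝓝 0))
    (hosc : ∀ h > 0, ∀ w, meanOscillation volume Ω h (T w) ≤ ρ h * ‖w‖ₑ)
    {F : W → ℝ} (hF : IsWeaklySeqLSC F) (hF_minorant : HasAffineMinorant F) {α β : ℝ}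
    (hα : 0 < α) (hβ : 0 ≤ β) : HasSolution Ω (fun w => T w) F α β := by
  have : IsFiniteMeasure (volume.restrict Ω) := ⟨by simpa using hμ.lt_top⟩
  have hsupport : IsWeaklySeqLSC fun w =>
      (volume.restrict Ω).real (Function.support (T w)) :=
    isWeaklySeqLSC_measureReal_support fun u w hu =>
      tendstoInMeasure_of_meanOscillation_le hΩ hΩD hμ T hρ hosc hu
  have hobjective : objective Ω (fun w => T w) F α β = fun w =>
      F w + α / 2 * ‖w‖ ^ 2 + β * (volume.restrict Ω).real (Function.support (T w)) := by
    ext w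
    rw [objective, integral_absPowZero
      (Lp.stronglyMeasurable (T w)).measurableSet_support.nullMeasurableSet]
  rw [HasSolution, hobjective]
  exact ((hF.add (isWeaklySeqLSC_norm_sq.const_mul (by positivity))).add
    (hsupport.const_mul hβ)).exists_forall_le
      (hF_minorant.tendsto_cobounded hα fun w => by positivity)

end Existence

/-! ### Completeness -/

theorem completeSpace_of_isClosed_image_closedBall {W H : Type*} [NormedAddCommGroup W]
    [NormedSpace ℝ W] [NormedAddCommGroup H] [NormedSpace ℝ H] [CompleteSpace H] {T : W →L[ℝ] H}
    (hT : Function.Injective T) (hclosed : ∀ R > 0, IsClosed (T '' Metric.closedBall 0 R)) :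
    CompleteSpace W := by
  refine Metric.complete_of_cauchySeq_tendsto fun u hu => ?_
  obtain ⟨x, hx⟩ := cauchySeq_tendsto_of_complete (T.uniformContinuous.comp_cauchySeq hu)
  have hlimit : ∀ R > 0, ∃ N, ∀ m ≥ N, ∃ v, T v = x - T (u m) ∧ ‖v‖ ≤ R := fun R hR => by
    obtain ⟨N, hN⟩ := Metric.cauchySeq_iff.1 hu R hR
    refine ⟨N, fun m hm => ?_⟩
    have hmem : x - T (u m) ∈ T '' Metric.closedBall 0 R := by
      refine (hclosed R hR).mem_of_tendsto (hx.sub_const (T (u m))) ?_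
      filter_upwards [eventually_ge_atTop N] with k hk
      refine ⟨u k - u m, ?_, map_sub _ _ _⟩
      rw [mem_closedBall_zero_iff, ← dist_eq_norm]
      exact (hN k hk m hm).le
    obtain ⟨v, hv, hTv⟩ := hmem
    exact ⟨v, hTv, mem_closedBall_zero_iff.1 hv⟩
  obtain ⟨w, rfl⟩ : ∃ w, T w = x := by
    obtain ⟨N, hN⟩ := hlimit 1 one_pos
    obtain ⟨v, hv, -⟩ := hN N le_rfl
    exact ⟨v + u N, by rw [map_add, hv, sub_add_cancel]⟩
  refine ⟨w, NormedAddCommGroup.tendsto_atTop.2 fun ε hε => ?_⟩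
  obtain ⟨N, hN⟩ := hlimit (ε / 2) (half_pos hε)
  refine ⟨N, fun m hm => ?_⟩
  obtain ⟨v, hv, hvε⟩ := hN m hm
  rw [← map_sub, hT.eq_iff] at hv
  rw [norm_sub_rev, ← hv]
  exact hvε.trans_lt (half_lt_self hε)

/-! ### The spaces `H^s(Ω)` and `H̃^s(Ω)` -/

section IntegralSpaces

theorem tendsto_rpow_nhdsGT_zero {s : ℝ} (hs : 0 < s) :
    Tendsto (fun h : ℝ => h ^ s) (𝓝[>] 0) (𝓝 0) := by
  simpa [Real.zero_rpow hs.ne'] using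
    (Real.continuousAt_rpow_const 0 s (.inr hs.le)).tendsto.mono_left nhdsWithin_le_nhds

theorem fracConst_pos (d : ℕ) (s : Set.Ioo (0 : ℝ) 1) : 0 < fracConst d s := by
  have hs := s.2.1
  have hGamma_num := Real.Gamma_pos_of_pos (add_pos_of_pos_of_nonneg hs
    (by positivity : (0 : ℝ) ≤ d / 2))
  have hGamma_den := Real.Gamma_pos_of_pos (sub_pos.2 s.2.2)
  exact div_pos (mul_pos (mul_pos hs (by positivity)) hGamma_num)
    (mul_pos (by positivity) hGamma_den)

theorem eLpNorm_two_sq {X E : Type*} {_ : MeasurableSpace X} {μ : Measure X}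
    [NormedAddCommGroup E] (f : X → E) : eLpNorm f 2 μ ^ 2 = ∫⁻ x, ‖f x‖ₑ ^ 2 ∂μ := by
  simpa using eLpNorm_nnreal_pow_eq_lintegral (f := f) (μ := μ) (p := 2) two_ne_zero

variable {d : ℕ} {Ω D : Set (Eucl d)}

theorem lowerSemicontinuous_eLpNorm_diffQuotient (s : ℝ) :
    LowerSemicontinuous fun w : L2 Ω => eLpNorm (diffQuotient s w) 2 (prodVolume Ω) := by
  refine lowerSemicontinuous_iff_isClosed_preimage.2 fun C =>
    IsSeqClosed.isClosed fun u w hu hlim => ?_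
  obtain ⟨φ, -, hφ⟩ := (tendstoInMeasure_of_tendsto_Lp hlim).exists_seq_tendsto_ae
  refine Lp.eLpNorm_le_of_ae_tendsto (u := atTop) (Eventually.of_forall fun k => hu (φ k)) (fun k =>
    (measurable_diffQuotient (Lp.stronglyMeasurable _).measurable s).aestronglyMeasurable) ?_
  filter_upwards [Measure.quasiMeasurePreserving_fst.ae hφ,
    Measure.quasiMeasurePreserving_snd.ae hφ] with z hfst hsnd
  exact (hfst.sub hsnd).div_const _

namespace Hs

variable {s : Set.Ioo (0 : ℝ) 1}

theorem enorm_sq_eq (w : Hs Ω s) :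
    ‖w‖ₑ ^ 2 = ‖toL2 w‖ₑ ^ 2 + ENNReal.ofReal (fracConst d s / 2) *
      eLpNorm (diffQuotient s (toL2 w)) 2 (prodVolume Ω) ^ 2 := by
  have hc := fracConst_nonneg d s
  have hquotient : eLpNorm (diffQuotient s (toL2 w)) 2 (prodVolume Ω) ^ 2 = ENNReal.ofReal
      (∫ z, diffQuotient s (toL2 w) z * diffQuotient s (toL2 w) z ∂(prodVolume Ω)) := by
    rw [ofReal_integral_eq_lintegral_ofReal (integrable_mul w w)
      (Eventually.of_forall fun z => mul_self_nonneg _)]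
    simp only [← sq, ← Real.enorm_of_nonneg (sq_nonneg _), enorm_pow]
    exact eLpNorm_two_sq _
  rw [hquotient, ← ofReal_norm, ← ofReal_norm, ← ENNReal.ofReal_pow (norm_nonneg _),
    ← ENNReal.ofReal_pow (norm_nonneg _), ← ENNReal.ofReal_mul (by positivity),
    ← ENNReal.ofReal_add (by positivity) (mul_nonneg (by positivity)
      (integral_nonneg fun z => mul_self_nonneg _)),
    ← real_inner_self_eq_norm_sq, ← real_inner_self_eq_norm_sq]
  exact congrArg _ (innerHs_eq w w)

theorem enorm_toL2_le (w : Hs Ω s) : ‖toL2 w‖ₑ ≤ ‖w‖ₑ := by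
  rw [← ENNReal.pow_le_pow_left_iff two_ne_zero, enorm_sq_eq]
  exact le_self_add

theorem eLpNorm_diffQuotient_le (w : Hs Ω s) :
    eLpNorm (diffQuotient s (toL2 w)) 2 (prodVolume Ω) ≤
      ENNReal.ofReal √(2 / fracConst d s) * ‖w‖ₑ := by
  have hc := fracConst_pos d s
  rw [← ENNReal.pow_le_pow_left_iff two_ne_zero, mul_pow, ← ENNReal.ofReal_pow (by positivity),
    Real.sq_sqrt (by positivity), enorm_sq_eq, mul_add, ← mul_assoc,
    ← ENNReal.ofReal_mul (by positivity), div_mul_div_cancel₀ hc.ne', div_self two_ne_zero,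
    ENNReal.ofReal_one, one_mul]
  exact le_add_self

/-- The continuous inclusion of `H^s(Ω)` into `L²(Ω)`. -/
def toL2CLM : Hs Ω s →L[ℝ] L2 Ω :=
  toL2.mkContinuous 1 fun w => by
    simpa [← ofReal_norm] using enorm_toL2_le w

instance : CompleteSpace (Hs Ω s) := by
  refine completeSpace_of_isClosed_image_closedBall (T := toL2CLM) Subtype.val_injective
    fun R hR => ?_
  have hc : ENNReal.ofReal (fracConst d s / 2) ≠ 0 := by
    simpa using fracConst_pos d s
  have hlsc : LowerSemicontinuous fun x : L2 Ω => ‖x‖ₑ ^ 2 + ENNReal.ofReal (fracConst d s / 2) *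
      eLpNorm (diffQuotient s x) 2 (prodVolume Ω) ^ 2 := by
    refine (by fun_prop : Continuous fun x : L2 Ω => ‖x‖ₑ ^ 2).lowerSemicontinuous.add ?_
    exact ((ENNReal.continuous_const_mul ENNReal.ofReal_ne_top).comp
      (ENNReal.continuous_pow 2)).comp_lowerSemicontinuous
        (lowerSemicontinuous_eLpNorm_diffQuotient s)
        ((mul_right_mono).comp (pow_left_mono 2))
  have hball : ∀ w : Hs Ω s, w ∈ Metric.closedBall 0 R ↔ ‖w‖ₑ ^ 2 ≤ ENNReal.ofReal R ^ 2 := by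
    intro w
    rw [mem_closedBall_zero_iff, ENNReal.pow_le_pow_left_iff two_ne_zero, ← ofReal_norm,
      ENNReal.ofReal_le_ofReal_iff hR.le]
  convert hlsc.isClosed_preimage (ENNReal.ofReal R ^ 2) using 1
  ext x
  constructor
  · rintro ⟨w, hw, rfl⟩
    exact (enorm_sq_eq w).symm.trans_le ((hball w).1 hw)
  · intro hx
    have hquotient : eLpNorm (diffQuotient s x) 2 (prodVolume Ω) < ⊤ := by
      refine lt_top_iff_ne_top.2 fun htop => ?_
      rw [Set.mem_preimage, htop, Set.mem_Iic] at hx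
      simp [hc] at hx
    have hxs : x ∈ hsSubmodule Ω s := ⟨(measurable_diffQuotient
      (Lp.stronglyMeasurable x).measurable s).aestronglyMeasurable, hquotient⟩
    exact ⟨⟨x, hxs⟩, (hball _).2 ((enorm_sq_eq _).trans_le hx), rfl⟩

end Hs

theorem isClosed_HTilde (s : Set.Ioo (0 : ℝ) 1) :
    IsClosed (HTilde Ω s : Set (Hs (Set.univ : Set (Eucl d)) s)) := by
  refine IsSeqClosed.isClosed fun u w hu hlim => ?_
  obtain ⟨φ, -, hφ⟩ := (tendstoInMeasure_of_tendsto_Lp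
    ((Hs.toL2CLM.continuous.tendsto w).comp hlim)).exists_seq_tendsto_ae
  replace hφ := ae_mono (Measure.restrict_univ (μ := (volume : Measure (Eucl d)))).ge hφ
  change ∀ᵐ x ∂(volume : Measure (Eucl d)), x ∉ Ω → Hs.toL2 w x = 0
  filter_upwards [hφ, ae_all_iff.2 fun k => hu (φ k)] with x hx hx0 hxΩ
  exact tendsto_nhds_unique hx (tendsto_const_nhds.congr fun k => (hx0 k hxΩ).symm)

theorem hasSolution_of_isClosed_submodule {s : Set.Ioo (0 : ℝ) 1} (hΩ : IsOpen Ω) (hΩD : Ω ⊆ D)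
    (hμ : volume Ω ≠ ⊤) {V : Submodule ℝ (Hs D s)} (hV : IsClosed (V : Set (Hs D s))) {F : V → ℝ}
    (hF : IsWeaklySeqLSC F) (hF_minorant : HasAffineMinorant F) {α β : ℝ} (hα : 0 < α)
    (hβ : 0 ≤ β) : HasSolution Ω (fun w : V => Hs.toL2 w.1) F α β := by
  have : CompleteSpace V := hV.completeSpace_coe
  set C : ℝ≥0∞ := (volume Ω / volume (Metric.ball (0 : Eucl d) 1)) ^ (1 / 2 : ℝ)
  set K : ℝ≥0∞ := ENNReal.ofReal √(2 / fracConst d s)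
  have hC_top : C ≠ ⊤ := ENNReal.rpow_ne_top_of_nonneg (by positivity)
    (ENNReal.div_ne_top hμ (Metric.measure_ball_pos _ _ one_pos).ne')
  have hlim : Tendsto (fun h : ℝ => C * ENNReal.ofReal (h ^ (s : ℝ)) * K) (𝓝[>] 0) (𝓝 0) := by
    simpa using ENNReal.Tendsto.mul_const
      (ENNReal.Tendsto.const_mul (ENNReal.tendsto_ofReal
        (tendsto_rpow_nhdsGT_zero s.2.1)) (.inr hC_top))
      (.inr ENNReal.ofReal_ne_top)
  refine hasSolution_of_meanOscillation_le hΩ hΩD hμ (Hs.toL2CLM ∘L V.subtypeL) hlim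
    (fun h hh w => ?_) hF hF_minorant hα hβ
  calc meanOscillation volume Ω h (Hs.toL2 w.1)
      ≤ C * ENNReal.ofReal (h ^ (s : ℝ)) *
          eLpNorm (diffQuotient s (Hs.toL2 w.1)) 2 (prodVolume Ω) :=
        meanOscillation_le_diffQuotient s.2.1.le (Lp.stronglyMeasurable _).measurable Ω hh
    _ ≤ C * ENNReal.ofReal (h ^ (s : ℝ)) *
          eLpNorm (diffQuotient s (Hs.toL2 w.1)) 2 (prodVolume D) := by
        gcongr
        rw [prodVolume, prodVolume, Measure.prod_restrict, Measure.prod_restrict]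
        exact Measure.restrict_mono (Set.prod_mono hΩD hΩD) le_rfl
    _ ≤ C * ENNReal.ofReal (h ^ (s : ℝ)) * (K * ‖w.1‖ₑ) := by
        gcongr
        exact Hs.eLpNorm_diffQuotient_le w.1
    _ = C * ENNReal.ofReal (h ^ (s : ℝ)) * K * ‖w‖ₑ := by
        rw [← mul_assoc]
        rfl

end IntegralSpaces

/-! ### Translations -/

section Translation

theorem enorm_add_sub_le_lintegral_fderiv {E F : Type*} [NormedAddCommGroup E] [NormedSpace ℝ E]
    [NormedAddCommGroup F] [NormedSpace ℝ F] [CompleteSpace F] {f : E → F} (hf : ContDiff ℝ 1 f)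
    (x z : E) : ‖f (x + z) - f x‖ₑ ≤
      ‖z‖ₑ * ∫⁻ t in Set.Ioc (0 : ℝ) 1, ‖fderiv ℝ f (x + t • z)‖ₑ := by
  have hf' : Continuous fun t : ℝ => fderiv ℝ f (x + t • z) :=
    (hf.continuous_fderiv one_ne_zero).comp (by fun_prop)
  have hderiv : ∀ t ∈ Set.uIcc (0 : ℝ) 1,
      HasDerivAt (fun t : ℝ => f (x + t • z)) (fderiv ℝ f (x + t • z) z) t := fun t _ =>
    ((hf.differentiable one_ne_zero _).hasFDerivAt).comp_hasDerivAt t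
      (by simpa using ((hasDerivAt_id t).smul_const z).const_add x)
  have hftc := intervalIntegral.integral_eq_sub_of_hasDerivAt hderiv
    ((hf'.clm_apply continuous_const).intervalIntegrable 0 1)
  simp only [one_smul, zero_smul, add_zero, intervalIntegral.integral_of_le zero_le_one] at hftc
  rw [← hftc, ← lintegral_const_mul _ hf'.enorm.measurable]
  refine (enorm_integral_le_lintegral_enorm _).trans (lintegral_mono fun t => ?_)
  rw [mul_comm]
  exact ContinuousLinearMap.le_opENorm _ _

theorem eLpNorm_add_sub_le_eLpNorm_fderiv {E F : Type*} [NormedAddCommGroup E] [NormedSpace ℝ E]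
    [MeasurableSpace E] [BorelSpace E] [SecondCountableTopology E] {μ : Measure E} [SFinite μ]
    [μ.IsAddRightInvariant] [NormedAddCommGroup F] [NormedSpace ℝ F] [CompleteSpace F] {p : ℝ≥0∞}
    (hp : 1 ≤ p) (hp_top : p ≠ ⊤) {f : E → F} (hf : ContDiff ℝ 1 f) (z : E) :
    eLpNorm (fun x => f (x + z) - f x) p μ ≤ ‖z‖ₑ * eLpNorm (fderiv ℝ f) p μ := by
  have hp0 : p ≠ 0 := (one_pos.trans_le hp).ne'
  have hp_pos : 0 < p.toReal := ENNReal.toReal_pos hp0 hp_top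
  set ν : Measure ℝ := volume.restrict (Set.Ioc 0 1) with hν
  have : IsProbabilityMeasure ν := ⟨by simp [hν]⟩
  have hf' : Continuous fun q : E × ℝ => fderiv ℝ f (q.1 + q.2 • z) :=
    (hf.continuous_fderiv one_ne_zero).comp (by fun_prop)
  have hjensen (x : E) : ‖f (x + z) - f x‖ₑ ^ p.toReal ≤
      ‖z‖ₑ ^ p.toReal * ∫⁻ t, ‖fderiv ℝ f (x + t • z)‖ₑ ^ p.toReal ∂ν := by
    have h1p := eLpNorm_le_eLpNorm_of_exponent_le (μ := ν) hp
      (hf'.comp (Continuous.prodMk_right x)).aestronglyMeasurable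
    rw [eLpNorm_one_eq_lintegral_enorm, eLpNorm_eq_lintegral_rpow_enorm_toReal hp0 hp_top,
      ← ENNReal.rpow_le_rpow_iff hp_pos, ← ENNReal.rpow_mul, one_div_mul_cancel hp_pos.ne',
      ENNReal.rpow_one] at h1p
    refine (ENNReal.rpow_le_rpow (enorm_add_sub_le_lintegral_fderiv hf x z) hp_pos.le).trans ?_
    rw [ENNReal.mul_rpow_of_nonneg _ _ hp_pos.le]
    gcongr
    exact h1p
  rw [eLpNorm_eq_lintegral_rpow_enorm_toReal hp0 hp_top,
    eLpNorm_eq_lintegral_rpow_enorm_toReal hp0 hp_top, ← ENNReal.rpow_le_rpow_iff hp_pos,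
    ENNReal.mul_rpow_of_nonneg _ _ hp_pos.le]
  simp only [← ENNReal.rpow_mul, one_div_mul_cancel hp_pos.ne', ENNReal.rpow_one]
  have hmeas : Measurable fun q : E × ℝ => ‖fderiv ℝ f (q.1 + q.2 • z)‖ₑ ^ p.toReal :=
    hf'.enorm.measurable.pow_const _
  calc ∫⁻ x, ‖f (x + z) - f x‖ₑ ^ p.toReal ∂μ
      ≤ ∫⁻ x, ‖z‖ₑ ^ p.toReal * ∫⁻ t, ‖fderiv ℝ f (x + t • z)‖ₑ ^ p.toReal ∂ν ∂μ :=
        lintegral_mono hjensen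
    _ = ‖z‖ₑ ^ p.toReal * ∫⁻ t, ∫⁻ x, ‖fderiv ℝ f (x + t • z)‖ₑ ^ p.toReal ∂μ ∂ν := by
        rw [lintegral_const_mul _ hmeas.lintegral_prod_right',
          lintegral_lintegral_swap hmeas.aemeasurable]
    _ = ‖z‖ₑ ^ p.toReal * ∫⁻ x, ‖fderiv ℝ f x‖ₑ ^ p.toReal ∂μ := by
        congr 1
        simp [lintegral_add_right_eq_self fun x => ‖fderiv ℝ f x‖ₑ ^ p.toReal]

variable {X E : Type*} [MeasurableSpace X] {μ : Measure X} [NormedAddCommGroup E] {p : ℝ≥0∞}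
  {A : Set X}

theorem memLp_indicator_coeFn (hA : MeasurableSet A) (w : Lp E p (μ.restrict A)) :
    MemLp (A.indicator w) p μ :=
  (memLp_indicator_iff_restrict hA).2 (Lp.memLp w)

variable [NormedSpace ℝ E] [Fact (1 ≤ p)]

/-- Extension by zero, as an isometry of `L^p(A)` into `L^p(X)`. -/
def extendZero (hA : MeasurableSet A) : Lp E p (μ.restrict A) →ₗᵢ[ℝ] Lp E p μ where
  toFun w := (memLp_indicator_coeFn hA w).toLp
  map_add' u w := by
    rw [← MemLp.toLp_add]
    refine MemLp.toLp_congr _ _ ?_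
    rw [← Set.indicator_add', ← ae_eq_restrict_iff_indicator_ae_eq hA]
    exact Lp.coeFn_add u w
  map_smul' a w := by
    rw [RingHom.id_apply, ← MemLp.toLp_const_smul]
    refine MemLp.toLp_congr _ _ ?_
    refine .trans ?_ (Set.indicator_const_smul A a w).eventuallyEq
    rw [← ae_eq_restrict_iff_indicator_ae_eq hA]
    exact Lp.coeFn_smul a w
  norm_map' w := by
    refine (Lp.norm_toLp _ (memLp_indicator_coeFn hA w)).trans ?_
    rw [eLpNorm_indicator_eq_eLpNorm_restrict hA, Lp.norm_def]

theorem coeFn_extendZero (hA : MeasurableSet A) (w : Lp E p (μ.restrict A)) :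
    extendZero hA w =ᵐ[μ] A.indicator w :=
  MemLp.coeFn_toLp (memLp_indicator_coeFn hA w)

variable [AddGroup X] [MeasurableAdd X] [μ.IsAddRightInvariant]

/-- The operator `w ↦ w(· + z) - w` on functions extended by zero outside `A`. -/
def translationSub (hA : MeasurableSet A) (z : X) : Lp E p (μ.restrict A) →L[ℝ] Lp E p μ :=
  (Lp.compMeasurePreservingₗᵢ ℝ _ (measurePreserving_add_right μ z)).toContinuousLinearMap ∘L
    (extendZero hA).toContinuousLinearMap - (extendZero hA).toContinuousLinearMap

theorem coeFn_translationSub (hA : MeasurableSet A) (z : X) (w : Lp E p (μ.restrict A)) :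
    translationSub hA z w =ᵐ[μ] fun x => A.indicator w (x + z) - A.indicator w x := by
  have hmp := measurePreserving_add_right μ z
  have hw := coeFn_extendZero hA w
  filter_upwards [Lp.coeFn_sub (Lp.compMeasurePreserving _ hmp (extendZero hA w)) (extendZero hA w),
    Lp.coeFn_compMeasurePreserving (extendZero hA w) hmp, hw,
    hmp.quasiMeasurePreserving.ae hw] with x hsub hcomp hx hxz
  exact hsub.trans (by rw [Pi.sub_apply, hcomp, Function.comp_apply, hxz, hx])

theorem norm_translationSub_le (hA : MeasurableSet A) (z : X) (w : Lp E p (μ.restrict A)) :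
    ‖translationSub hA z w‖ ≤ 2 * ‖w‖ := by
  refine (norm_sub_le _ _).trans_eq ?_
  rw [two_mul]
  exact congrArg₂ _ ((Lp.norm_compMeasurePreserving (extendZero hA w)
    (measurePreserving_add_right μ z)).trans (LinearIsometry.norm_map _ _))
    (LinearIsometry.norm_map _ _)

theorem norm_le_norm_translationSub (hA : MeasurableSet A) {z : X} (hz : ∀ x ∈ A, x + z ∉ A)
    (w : Lp E p (μ.restrict A)) : ‖w‖ ≤ ‖translationSub hA z w‖ := by
  rw [← enorm_le_iff_norm_le, Lp.enorm_def, Lp.enorm_def]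
  refine (eLpNorm_congr_norm_ae ?_).trans_le (eLpNorm_mono_measure _ Measure.restrict_le_self)
  filter_upwards [ae_restrict_of_ae (coeFn_translationSub hA z w), ae_restrict_mem hA] with x hx hxA
  rw [hx, Set.indicator_of_notMem (hz x hxA), Set.indicator_of_mem hxA, zero_sub, norm_neg]

theorem setLIntegral_indicator_add_sub_le (hA : MeasurableSet A) (z : X)
    (w : Lp E p (μ.restrict A)) :
    ∫⁻ x in A, ‖A.indicator w (x + z) - A.indicator w x‖ₑ ∂μ ≤
      ‖translationSub hA z w‖ₑ * μ A ^ (1 - 1 / p.toReal) := by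
  calc ∫⁻ x in A, ‖A.indicator w (x + z) - A.indicator w x‖ₑ ∂μ
      = eLpNorm (translationSub hA z w) 1 (μ.restrict A) := by
        rw [eLpNorm_one_eq_lintegral_enorm]
        refine lintegral_congr_ae ?_
        filter_upwards [ae_restrict_of_ae (coeFn_translationSub hA z w)] with x hx
        rw [hx]
    _ ≤ eLpNorm (translationSub hA z w) p (μ.restrict A) * μ A ^ (1 - 1 / p.toReal) := by
        simpa using eLpNorm_le_eLpNorm_mul_rpow_measure_univ (μ := μ.restrict A) (Fact.out : 1 ≤ p)
          (Lp.aestronglyMeasurable (translationSub hA z w)).restrict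
    _ ≤ ‖translationSub hA z w‖ₑ * μ A ^ (1 - 1 / p.toReal) := by
        rw [Lp.enorm_def]
        gcongr
        exact Measure.restrict_le_self

theorem exists_forall_add_notMem {E : Type*} [NormedAddCommGroup E] [NormedSpace ℝ E]
    [Nontrivial E] {A : Set E} (hA : Bornology.IsBounded A) : ∃ z, ∀ x ∈ A, x + z ∉ A := by
  obtain ⟨R, hR⟩ := hA.subset_ball 0
  obtain ⟨z, hz⟩ := NormedSpace.exists_lt_norm ℝ E (R + R)
  refine ⟨z, fun x hx hxz => hz.not_ge ?_⟩
  calc ‖z‖ = ‖(x + z) - x‖ := by rw [add_sub_cancel_left]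
    _ ≤ ‖x + z‖ + ‖x‖ := norm_sub_le _ _
    _ ≤ R + R := add_le_add (mem_ball_zero_iff.1 (hR hxz)).le (mem_ball_zero_iff.1 (hR hx)).le

end Translation

/-! ### Dirichlet eigenfunctions -/

section EigenGraph

variable {H K : Type*} [NormedAddCommGroup H] [InnerProductSpace ℝ H] [NormedAddCommGroup K]
  [InnerProductSpace ℝ K] {V : Submodule ℝ (H × K)} {a b : ℝ}

/-- For a linear operator `T` from `H` to `K` with graph `V`, the pairs `(u, T u)` such that `u` is
an eigenvector of `T* T` to the eigenvalue `a`, in the weak sense `⟪T u, T v⟫ = a ⟪u, v⟫`. -/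
def eigenGraph (V : Submodule ℝ (H × K)) (a : ℝ) : Submodule ℝ (H × K) where
  carrier := {p | p ∈ V ∧ ∀ q ∈ V, inner ℝ p.2 q.2 = a * inner ℝ p.1 q.1}
  zero_mem' := ⟨zero_mem _, by simp⟩
  add_mem' := by
    rintro p q ⟨hp, hp'⟩ ⟨hq, hq'⟩
    refine ⟨add_mem hp hq, fun r hr => ?_⟩
    rw [Prod.snd_add, Prod.fst_add, inner_add_left, inner_add_left, hp' r hr, hq' r hr, mul_add]
  smul_mem' := by
    rintro c p ⟨hp, hp'⟩
    refine ⟨Submodule.smul_mem _ c hp, fun r hr => ?_⟩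
    rw [Prod.smul_snd, Prod.smul_fst, real_inner_smul_left, real_inner_smul_left, hp' r hr,
      mul_left_comm]

theorem isClosed_eigenGraph (hV : IsClosed (V : Set (H × K))) (a : ℝ) :
    IsClosed (eigenGraph V a : Set (H × K)) := by
  have : (eigenGraph V a : Set (H × K)) =
      (V : Set (H × K)) ∩ ⋂ q ∈ V, {p | inner ℝ p.2 q.2 = a * inner ℝ p.1 q.1} := by
    ext p
    simp [eigenGraph]
  rw [this]
  exact hV.inter (isClosed_biInter fun q _ => isClosed_eq (by fun_prop) (by fun_prop))

theorem norm_snd_of_mem_eigenGraph {p : H × K} (hp : p ∈ eigenGraph V a) :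
    ‖p.2‖ = √a * ‖p.1‖ := by
  rw [← Real.sqrt_sq (norm_nonneg p.2), ← real_inner_self_eq_norm_sq, hp.2 p hp.1,
    real_inner_self_eq_norm_sq, Real.sqrt_mul' _ (sq_nonneg _), Real.sqrt_sq (norm_nonneg _)]

theorem isClosed_map_fst_eigenGraph [CompleteSpace H] [CompleteSpace K]
    (hV : IsClosed (V : Set (H × K))) (a : ℝ) :
    IsClosed ((eigenGraph V a).map (LinearMap.fst ℝ H K) : Set H) := by
  have : CompleteSpace (eigenGraph V a) := (isClosed_eigenGraph hV a).completeSpace_coe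
  let T : eigenGraph V a →L[ℝ] H := ContinuousLinearMap.fst ℝ H K ∘L (eigenGraph V a).subtypeL
  have hT : AntilipschitzWith (max 1 ⟨√a, Real.sqrt_nonneg a⟩) T := by
    refine T.antilipschitz_of_bound fun p => ?_
    change max ‖p.1.1‖ ‖p.1.2‖ ≤ max 1 √a * ‖p.1.1‖
    rw [norm_snd_of_mem_eigenGraph p.2, max_mul_of_nonneg _ _ (norm_nonneg _), one_mul]
  convert hT.isClosed_range T.uniformContinuous using 1
  ext u
  simp [T]

theorem inner_fst_eq_zero_of_mem_eigenGraph (hab : a ≠ b) {p q : H × K}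
    (hp : p ∈ eigenGraph V a) (hq : q ∈ eigenGraph V b) : inner ℝ p.1 q.1 = 0 := by
  have hpq := hp.2 q hq.1
  have hqp := hq.2 p hp.1
  rw [real_inner_comm, hpq, real_inner_comm p.1] at hqp
  exact (mul_eq_mul_right_iff.1 hqp).resolve_left hab

theorem norm_sum_snd_sq_of_mem_eigenGraph {ι : Type*} {a : ι → ℝ} (ha : Function.Injective a)
    {p : ι → H × K} (hp : ∀ i, p i ∈ eigenGraph V (a i)) (t : Finset ι) :
    ‖∑ i ∈ t, (p i).2‖ ^ 2 = ∑ i ∈ t, a i * ‖(p i).1‖ ^ 2 := by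
  rw [← real_inner_self_eq_norm_sq, sum_inner]
  refine Finset.sum_congr rfl fun i hi => ?_
  rw [inner_sum, Finset.sum_eq_single_of_mem i hi, (hp i).2 _ (hp i).1, real_inner_self_eq_norm_sq]
  intro j _ hj
  rw [(hp i).2 _ (hp j).1, inner_fst_eq_zero_of_mem_eigenGraph (ha.ne hj.symm) (hp i) (hp j),
    mul_zero]

end EigenGraph

namespace IsTestFunction

variable {d : ℕ} {Ω : Set (Eucl d)} {φ ψ : Eucl d → ℝ}

theorem zero : IsTestFunction Ω (0 : Eucl d → ℝ) :=
  ⟨contDiff_const, HasCompactSupport.zero, by simp [tsupport]⟩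

theorem add (hφ : IsTestFunction Ω φ) (hψ : IsTestFunction Ω ψ) : IsTestFunction Ω (φ + ψ) where
  contDiff := hφ.contDiff.add hψ.contDiff
  hasCompactSupport := hφ.hasCompactSupport.add hψ.hasCompactSupport
  tsupport_subset := (tsupport_add φ ψ).trans
    (Set.union_subset hφ.tsupport_subset hψ.tsupport_subset)

theorem const_smul (hφ : IsTestFunction Ω φ) (a : ℝ) : IsTestFunction Ω (a • φ) where
  contDiff := hφ.contDiff.const_smul a
  hasCompactSupport := hφ.hasCompactSupport.smul_left (f := fun _ => a)
  tsupport_subset := (tsupport_smul_subset_right (fun _ => a) φ).trans hφ.tsupport_subset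

theorem differentiable (hφ : IsTestFunction Ω φ) : Differentiable ℝ φ :=
  hφ.contDiff.differentiable (by simp)

theorem gradient_add (hφ : IsTestFunction Ω φ) (hψ : IsTestFunction Ω ψ) :
    gradient (φ + ψ) = gradient φ + gradient ψ := by
  ext1 x
  simp only [gradient, Pi.add_apply]
  rw [fderiv_add (hφ.differentiable x) (hψ.differentiable x), map_add]

theorem gradient_const_smul (hφ : IsTestFunction Ω φ) (a : ℝ) :
    gradient (a • φ) = a • gradient φ := by
  ext1 x
  simp only [gradient, Pi.smul_apply]
  rw [fderiv_const_smul (hφ.differentiable x), map_smulₛₗ]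
  simp

theorem memLp (hφ : IsTestFunction Ω φ) : MemLp φ 2 (volume.restrict Ω) :=
  (hφ.contDiff.continuous.memLp_of_hasCompactSupport hφ.hasCompactSupport).restrict Ω

theorem memLp_gradient (hφ : IsTestFunction Ω φ) : MemLp (gradient φ) 2 (volume.restrict Ω) := by
  have hcont : Continuous (gradient φ) := (InnerProductSpace.toDual ℝ (Eucl d)).symm.continuous.comp
    (hφ.contDiff.continuous_fderiv (by simp))
  exact (hcont.memLp_of_hasCompactSupport ((hφ.hasCompactSupport.fderiv ℝ).comp_left
    (map_zero (InnerProductSpace.toDual ℝ (Eucl d)).symm))).restrict Ω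

theorem eLpNorm_fderiv_eq (hφ : IsTestFunction Ω φ) (p : ℝ≥0∞) :
    eLpNorm (fderiv ℝ φ) p = eLpNorm (gradient φ) p (volume.restrict Ω) := by
  have hsupport : (gradient φ).support ⊆ Ω := fun x hx =>
    hφ.tsupport_subset (support_fderiv_subset ℝ fun h => hx (by simp [gradient, h]))
  rw [eLpNorm_restrict_eq_of_support_subset hsupport]
  exact eLpNorm_congr_norm_ae (Eventually.of_forall fun x =>
    (LinearIsometryEquiv.norm_map _ _).symm)

end IsTestFunction

section DirichletEigenspace

variable {d : ℕ} {Ω : Set (Eucl d)}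

/-- The Hilbert space `L²(Ω; ℝ^d)`. -/
abbrev L2Vec (Ω : Set (Eucl d)) : Type := Lp (Eucl d) 2 (volume.restrict Ω)

/-- The graph of the gradient on test functions. -/
def testGradientGraph (Ω : Set (Eucl d)) : Submodule ℝ (L2 Ω × L2Vec Ω) where
  carrier := {p | ∃ φ, IsTestFunction Ω φ ∧ p.1 =ᵐ[volume.restrict Ω] φ ∧
    p.2 =ᵐ[volume.restrict Ω] gradient φ}
  zero_mem' := ⟨0, IsTestFunction.zero, Lp.coeFn_zero _ _ _,
    (Lp.coeFn_zero _ _ _).trans (gradient_const' (0 : ℝ)).symm.eventuallyEq⟩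
  add_mem' := by
    rintro p q ⟨φ, hφ, hpφ, hpφ'⟩ ⟨ψ, hψ, hqψ, hqψ'⟩
    refine ⟨φ + ψ, hφ.add hψ, (Lp.coeFn_add _ _).trans (hpφ.add hqψ), ?_⟩
    rw [hφ.gradient_add hψ]
    exact (Lp.coeFn_add _ _).trans (hpφ'.add hqψ')
  smul_mem' := by
    rintro a p ⟨φ, hφ, hpφ, hpφ'⟩
    refine ⟨a • φ, hφ.const_smul a, (Lp.coeFn_smul _ _).trans (hpφ.const_smul a), ?_⟩
    rw [hφ.gradient_const_smul]
    exact (Lp.coeFn_smul _ _).trans (hpφ'.const_smul a)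

/-- The graph of the weak gradient on `H_0^1(Ω)`. -/
def gradientGraph (Ω : Set (Eucl d)) : Submodule ℝ (L2 Ω × L2Vec Ω) :=
  (testGradientGraph Ω).topologicalClosure

theorem isClosed_gradientGraph (Ω : Set (Eucl d)) :
    IsClosed (gradientGraph Ω : Set (L2 Ω × L2Vec Ω)) :=
  Submodule.isClosed_topologicalClosure _

theorem gradientGraph_induction {P : L2 Ω × L2Vec Ω → Prop} (hP : IsClosed {p | P p})
    (h : ∀ p ∈ testGradientGraph Ω, P p) {p : L2 Ω × L2Vec Ω} (hp : p ∈ gradientGraph Ω) : P p :=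
  closure_minimal (show (testGradientGraph Ω : Set (L2 Ω × L2Vec Ω)) ⊆ {p | P p} from h) hP hp

theorem HasH01Gradient.mem_gradientGraph {w : L2 Ω} {G : Eucl d → Eucl d}
    (h : HasH01Gradient Ω w G) : (w, h.memLp_grad.toLp G) ∈ gradientGraph Ω := by
  obtain ⟨φ, hφ, hφw, hφG⟩ := h.approx
  refine mem_closure_of_tendsto (b := atTop)
    (f := fun n => ((hφ n).memLp.toLp (φ n), (hφ n).memLp_gradient.toLp (gradient (φ n))))
    (Tendsto.prodMk_nhds ?_ ?_) (Eventually.of_forall fun n =>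
      ⟨φ n, hφ n, (hφ n).memLp.coeFn_toLp, (hφ n).memLp_gradient.coeFn_toLp⟩)
  · rwa [← Lp.tendsto_Lp_iff_tendsto_eLpNorm'' φ (fun n => (hφ n).memLp) w h.memLp,
      Lp.toLp_coeFn] at hφw
  · rwa [← Lp.tendsto_Lp_iff_tendsto_eLpNorm'' _ (fun n => (hφ n).memLp_gradient) G
      h.memLp_grad] at hφG

theorem norm_translationSub_le_of_mem_gradientGraph (hΩ : MeasurableSet Ω) (z : Eucl d)
    {p : L2 Ω × L2Vec Ω} (hp : p ∈ gradientGraph Ω) :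
    ‖translationSub hΩ z p.1‖ ≤ ‖z‖ * ‖p.2‖ := by
  refine gradientGraph_induction (P := fun p => ‖translationSub hΩ z p.1‖ ≤ ‖z‖ * ‖p.2‖)
    (isClosed_le (by fun_prop) (by fun_prop)) ?_ hp
  rintro ⟨u, g⟩ ⟨φ, hφ, huφ, hgφ⟩
  have hmp := measurePreserving_add_right (volume : Measure (Eucl d)) z
  have hu : Ω.indicator u =ᵐ[volume] φ := by
    rw [← Set.indicator_eq_self.2 ((subset_tsupport φ).trans hφ.tsupport_subset)]
    exact (ae_eq_restrict_iff_indicator_ae_eq hΩ).1 huφ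
  have hdiff : translationSub hΩ z u =ᵐ[volume] fun x => φ (x + z) - φ x := by
    filter_upwards [coeFn_translationSub hΩ z u, hu, hmp.quasiMeasurePreserving.ae hu]
      with x hx hxu hxzu
    rw [hx, hxu, hxzu]
  have henorm : ‖translationSub hΩ z u‖ₑ ≤ ‖z‖ₑ * ‖g‖ₑ := by
    rw [Lp.enorm_def, Lp.enorm_def, eLpNorm_congr_ae hdiff, eLpNorm_congr_ae hgφ,
      ← hφ.eLpNorm_fderiv_eq]
    exact eLpNorm_add_sub_le_eLpNorm_fderiv one_le_two ENNReal.ofNat_ne_top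
      (hφ.contDiff.of_le (by simp)) z
  simpa using ENNReal.toReal_mono (by finiteness) henorm

theorem IsDirichletSolution.mem_map_fst_eigenGraph {a : ℝ} {w : L2 Ω}
    (h : IsDirichletSolution Ω a w) :
    w ∈ (eigenGraph (gradientGraph Ω) a).map (LinearMap.fst ℝ (L2 Ω) (L2Vec Ω)) := by
  obtain ⟨G, hG, hweak⟩ := h
  refine ⟨(w, hG.memLp_grad.toLp G), ⟨hG.mem_gradientGraph, fun q hq => ?_⟩, rfl⟩
  refine gradientGraph_induction
    (P := fun q => inner ℝ (hG.memLp_grad.toLp G) q.2 = a * inner ℝ w q.1)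
    (isClosed_eq (by fun_prop) (by fun_prop)) ?_ hq
  rintro ⟨u, g⟩ ⟨φ, hφ, huφ, hgφ⟩
  calc inner ℝ (hG.memLp_grad.toLp G) g
      = ∫ x in Ω, inner ℝ (G x) (gradient φ x) := by
        refine integral_congr_ae ?_
        filter_upwards [hG.memLp_grad.coeFn_toLp, hgφ] with x hxG hxφ
        rw [hxG, hxφ]
    _ = a * ∫ x in Ω, w x * φ x := hweak φ hφ
    _ = a * inner ℝ w u := by
        congr 1
        refine integral_congr_ae ?_
        filter_upwards [huφ] with x hx
        simp [hx, mul_comm]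

theorem dirichletEigenspace_le_map_fst_eigenGraph (Ω : Set (Eucl d)) (a : ℝ) :
    dirichletEigenspace Ω a ≤
      (eigenGraph (gradientGraph Ω) a).map (LinearMap.fst ℝ (L2 Ω) (L2Vec Ω)) :=
  Submodule.topologicalClosure_minimal _
    (Submodule.span_le.2 fun _ hv => IsDirichletSolution.mem_map_fst_eigenGraph hv)
    (isClosed_map_fst_eigenGraph (isClosed_gradientGraph Ω) a)

theorem orthogonalFamily_dirichletEigenspace (Ω : Set (Eucl d)) :
    OrthogonalFamily ℝ (fun a : PosReal => dirichletEigenspace Ω a)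
      fun a => (dirichletEigenspace Ω a).subtypeₗᵢ := by
  rintro a b hab ⟨u, hu⟩ ⟨v, hv⟩
  obtain ⟨p, hp, rfl⟩ := dirichletEigenspace_le_map_fst_eigenGraph Ω a hu
  obtain ⟨q, hq, rfl⟩ := dirichletEigenspace_le_map_fst_eigenGraph Ω b hv
  exact inner_fst_eq_zero_of_mem_eigenGraph (Subtype.coe_ne_coe.2 hab) hp hq

theorem norm_translationSub_sum_sq_le (hΩ : MeasurableSet Ω) (z : Eucl d) (t : Finset PosReal)
    {v : PosReal → L2 Ω} (hv : ∀ a : PosReal, v a ∈ dirichletEigenspace Ω a) :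
    ‖translationSub hΩ z (∑ a ∈ t, v a)‖ ^ 2 ≤ ∑ a ∈ t, ‖z‖ ^ 2 * a * ‖v a‖ ^ 2 := by
  choose p hp hpv using fun a : PosReal => dirichletEigenspace_le_map_fst_eigenGraph Ω a (hv a)
  have hpV : ∑ a ∈ t, p a ∈ gradientGraph Ω := Submodule.sum_mem _ fun a _ => (hp a).1
  calc ‖translationSub hΩ z (∑ a ∈ t, v a)‖ ^ 2
      = ‖translationSub hΩ z (∑ a ∈ t, p a).1‖ ^ 2 := by
        simp only [Prod.fst_sum, ← hpv, LinearMap.fst_apply]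
    _ ≤ (‖z‖ * ‖(∑ a ∈ t, p a).2‖) ^ 2 := by
        gcongr
        exact norm_translationSub_le_of_mem_gradientGraph hΩ z hpV
    _ = ∑ a ∈ t, ‖z‖ ^ 2 * a * ‖v a‖ ^ 2 := by
        rw [mul_pow, Prod.snd_sum,
          norm_sum_snd_sq_of_mem_eigenGraph Subtype.val_injective hp, Finset.mul_sum]
        simp only [← hpv, LinearMap.fst_apply, mul_assoc]

theorem norm_sum_sq_of_mem_dirichletEigenspace (t : Finset PosReal) {v : PosReal → L2 Ω}
    (hv : ∀ a : PosReal, v a ∈ dirichletEigenspace Ω a) :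
    ‖∑ a ∈ t, v a‖ ^ 2 = ∑ a ∈ t, ‖v a‖ ^ 2 :=
  (orthogonalFamily_dirichletEigenspace Ω).norm_sum (fun a => ⟨v a, hv a⟩) t

end DirichletEigenspace

/-! ### The spectral space `ℍ^s(Ω)` -/

theorem hasSum_starProjection_of_orthogonalFamily {𝕜 E ι : Type*} [RCLike 𝕜] [NormedAddCommGroup E]
    [InnerProductSpace 𝕜 E] [CompleteSpace E] {V : ι → Submodule 𝕜 E} [∀ i, CompleteSpace (V i)]
    (hV : OrthogonalFamily 𝕜 (fun i => V i) fun i => (V i).subtypeₗᵢ) {x : E}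
    (hx : x ∈ (⨆ i, V i).topologicalClosure) : HasSum (fun i => (V i).starProjection x) x := by
  obtain ⟨f, rfl⟩ : ∃ f, hV.linearIsometry f = x := by
    have hrange : x ∈ LinearMap.range hV.linearIsometry.toLinearMap := by
      rw [hV.range_linearIsometry]
      simpa using hx
    exact hrange
  have hf := hV.hasSum_linearIsometry f
  refine hf.congr_fun fun i => ?_
  refine ((hf.mapL (V i).starProjection).unique (hasSum_single i fun j hji => ?_)).trans
    (Submodule.starProjection_eq_self_iff.2 (f i).2)
  exact (Submodule.starProjection_apply_eq_zero_iff _).2 fun v hv => hV hji.symm ⟨v, hv⟩ (f j)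

theorem summable_of_tsum_ofReal_ne_top {ι : Type*} {f : ι → ℝ} (hf : ∀ i, 0 ≤ f i)
    (hsum : ∑' i, ENNReal.ofReal (f i) ≠ ⊤) : Summable f :=
  (ENNReal.summable_toReal hsum).congr fun i => ENNReal.toReal_ofReal (hf i)

section SpectralSpace

variable {d : ℕ} {Ω : Set (Eucl d)}

theorem norm_translationSub_sum_le (hΩ : MeasurableSet Ω) (z : Eucl d) {s : ℝ} (hs₀ : 0 ≤ s)
    (hs₁ : s ≤ 1) (t : Finset PosReal) {v : PosReal → L2 Ω}
    (hv : ∀ a : PosReal, v a ∈ dirichletEigenspace Ω a) :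
    ‖translationSub hΩ z (∑ a ∈ t, v a)‖ ≤ 3 * √(∑ a ∈ t, (‖z‖ ^ 2 * a) ^ s * ‖v a‖ ^ 2) := by
  set S := ∑ a ∈ t, (‖z‖ ^ 2 * a) ^ s * ‖v a‖ ^ 2
  have hnonneg : ∀ a : PosReal, 0 ≤ ‖z‖ ^ 2 * a := fun a => mul_nonneg (sq_nonneg _) a.2.le
  have hfilter (P : PosReal → Prop) [DecidablePred P] :
      ∑ a ∈ t with P a, (‖z‖ ^ 2 * a) ^ s * ‖v a‖ ^ 2 ≤ S :=
    Finset.sum_le_sum_of_subset_of_nonneg (Finset.filter_subset _ _) fun a _ _ =>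
      mul_nonneg (Real.rpow_nonneg (hnonneg a) s) (sq_nonneg _)
  have hlow : ‖translationSub hΩ z (∑ a ∈ t with ‖z‖ ^ 2 * a.1 ≤ 1, v a)‖ ≤ √S := by
    refine Real.le_sqrt_of_sq_le ((norm_translationSub_sum_sq_le hΩ z _ hv).trans
      ((Finset.sum_le_sum fun a ha => ?_).trans (hfilter _)))
    gcongr
    exact Real.self_le_rpow_of_le_one (hnonneg a) (Finset.mem_filter.1 ha).2 hs₁
  have hhigh : ‖∑ a ∈ t with ¬‖z‖ ^ 2 * a.1 ≤ 1, v a‖ ≤ √S := by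
    refine Real.le_sqrt_of_sq_le ((norm_sum_sq_of_mem_dirichletEigenspace _ hv).trans_le
      ((Finset.sum_le_sum fun a ha => ?_).trans (hfilter _)))
    exact le_mul_of_one_le_left (sq_nonneg _)
      (Real.one_le_rpow (not_le.1 (Finset.mem_filter.1 ha).2).le hs₀)
  calc ‖translationSub hΩ z (∑ a ∈ t, v a)‖
      ≤ ‖translationSub hΩ z (∑ a ∈ t with ‖z‖ ^ 2 * a.1 ≤ 1, v a)‖ +
          ‖translationSub hΩ z (∑ a ∈ t with ¬‖z‖ ^ 2 * a.1 ≤ 1, v a)‖ := by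
        rw [← Finset.sum_filter_add_sum_filter_not t fun a : PosReal => ‖z‖ ^ 2 * a.1 ≤ 1, map_add]
        exact norm_add_le _ _
    _ ≤ √S + 2 * √S := by
        gcongr
        exact (norm_translationSub_le hΩ z _).trans (by gcongr)
    _ = 3 * √S := by ring

namespace SpecHs

variable {s : Set.Ioo (0 : ℝ) 1}

theorem hasSum_norm_sq (w : SpecHs Ω s) :
    HasSum (fun a : PosReal => (a : ℝ) ^ (s : ℝ) * ‖eigenProj Ω a (toL2 w)‖ ^ 2) (‖w‖ ^ 2) := by
  have hsum : HasSum _ (innerSpec w w) := (summable_inner w w).hasSum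
  have hnorm : ‖w‖ ^ 2 = innerSpec w w := (real_inner_self_eq_norm_sq w).symm
  rw [hnorm]
  simpa only [real_inner_self_eq_norm_sq] using hsum

theorem norm_translationSub_toL2_le (hΩ : MeasurableSet Ω) (z : Eucl d) (w : SpecHs Ω s) :
    ‖translationSub hΩ z (toL2 w)‖ ≤ 3 * ‖z‖ ^ (s : ℝ) * ‖w‖ := by
  have hexpansion := ((hasSum_starProjection_of_orthogonalFamily
    (orthogonalFamily_dirichletEigenspace Ω) w.2.1).mapL (translationSub hΩ z)).norm
  refine le_of_tendsto hexpansion (Eventually.of_forall fun t => ?_)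
  rw [← map_sum]
  refine (norm_translationSub_sum_le hΩ z s.2.1.le s.2.2.le t fun a =>
    Submodule.starProjection_apply_mem _ _).trans ?_
  rw [mul_assoc]
  gcongr
  refine Real.sqrt_le_iff.2 ⟨by positivity, ?_⟩
  calc ∑ a ∈ t, (‖z‖ ^ 2 * a) ^ (s : ℝ) * ‖eigenProj Ω a (toL2 w)‖ ^ 2
      = (‖z‖ ^ (s : ℝ)) ^ 2 *
          ∑ a ∈ t, (a : ℝ) ^ (s : ℝ) * ‖eigenProj Ω a (toL2 w)‖ ^ 2 := by
        rw [Finset.mul_sum]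
        refine Finset.sum_congr rfl fun a _ => ?_
        rw [Real.mul_rpow (sq_nonneg _) a.2.le, Real.rpow_pow_comm (norm_nonneg z), mul_assoc]
    _ ≤ (‖z‖ ^ (s : ℝ)) ^ 2 * ‖w‖ ^ 2 := by
        gcongr
        exact sum_le_hasSum t (fun a _ => mul_nonneg (Real.rpow_nonneg a.2.le _) (sq_nonneg _))
          (hasSum_norm_sq w)
    _ = (‖z‖ ^ (s : ℝ) * ‖w‖) ^ 2 := (mul_pow _ _ _).symm

theorem exists_norm_toL2_le [Nontrivial (Eucl d)] (hΩ : MeasurableSet Ω)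
    (hΩb : Bornology.IsBounded Ω) (s : Set.Ioo (0 : ℝ) 1) :
    ∃ C, ∀ w : SpecHs Ω s, ‖toL2 w‖ ≤ C * ‖w‖ := by
  obtain ⟨z, hz⟩ := exists_forall_add_notMem hΩb
  exact ⟨3 * ‖z‖ ^ (s : ℝ), fun w =>
    (norm_le_norm_translationSub hΩ hz _).trans (norm_translationSub_toL2_le hΩ z w)⟩

theorem lowerSemicontinuous_tsum_eigenProj (Ω : Set (Eucl d)) (s : ℝ) :
    LowerSemicontinuous fun x : L2 Ω =>
      ∑' a : PosReal, ENNReal.ofReal ((a : ℝ) ^ s * ‖eigenProj Ω a x‖ ^ 2) :=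
  lowerSemicontinuous_tsum fun _ =>
    (ENNReal.continuous_ofReal.comp (by fun_prop)).lowerSemicontinuous

theorem completeSpace_of_norm_toL2_le {C : ℝ} (hC : ∀ w : SpecHs Ω s, ‖toL2 w‖ ≤ C * ‖w‖) :
    CompleteSpace (SpecHs Ω s) := by
  refine completeSpace_of_isClosed_image_closedBall (T := toL2.mkContinuous C hC)
    Subtype.val_injective fun R hR => ?_
  have hnonneg : ∀ (x : L2 Ω) (a : PosReal), 0 ≤ (a : ℝ) ^ (s : ℝ) * ‖eigenProj Ω a x‖ ^ 2 :=
    fun x a => mul_nonneg (Real.rpow_nonneg a.2.le _) (sq_nonneg _)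
  have hball : ∀ w : SpecHs Ω s, w ∈ Metric.closedBall 0 R ↔
      ∑' a : PosReal, ENNReal.ofReal ((a : ℝ) ^ (s : ℝ) * ‖eigenProj Ω a (toL2 w)‖ ^ 2) ≤
        ENNReal.ofReal (R ^ 2) := by
    intro w
    rw [← ENNReal.ofReal_tsum_of_nonneg (hnonneg _) (hasSum_norm_sq w).summable,
      (hasSum_norm_sq w).tsum_eq, ENNReal.ofReal_le_ofReal_iff (sq_nonneg R),
      mem_closedBall_zero_iff, sq_le_sq₀ (norm_nonneg w) hR.le]
  convert (Submodule.isClosed_topologicalClosure (⨆ a : PosReal, dirichletEigenspace Ω a)).inter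
    ((lowerSemicontinuous_tsum_eigenProj Ω s).isClosed_preimage (ENNReal.ofReal (R ^ 2))) using 1
  ext x
  constructor
  · rintro ⟨w, hw, rfl⟩
    exact ⟨w.2.1, (hball w).1 hw⟩
  · rintro ⟨hx, hxR⟩
    have hxs : x ∈ spectralSubmodule Ω s := ⟨hx, summable_of_tsum_ofReal_ne_top (hnonneg x)
      (ne_top_of_le_ne_top ENNReal.ofReal_ne_top hxR)⟩
    exact ⟨⟨x, hxs⟩, (hball ⟨x, hxs⟩).2 hxR, rfl⟩

theorem meanOscillation_toL2_le (hΩ : MeasurableSet Ω) {h : ℝ} (hh : 0 < h) (w : SpecHs Ω s) :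
    meanOscillation volume Ω h (toL2 w) ≤
      ENNReal.ofReal (3 * h ^ (s : ℝ)) * volume Ω ^ (1 / 2 : ℝ) * ‖w‖ₑ := by
  have hextend : toL2 w =ᵐ[volume.restrict Ω] Ω.indicator (toL2 w) :=
    (indicator_ae_eq_restrict hΩ).symm
  rw [meanOscillation_congr_ae hextend hh]
  refine meanOscillation_le_of_translation ((Lp.stronglyMeasurable _).indicator hΩ) hh
    fun z hz => ?_
  have hnorm : ‖translationSub hΩ z (toL2 w)‖ₑ ≤ ENNReal.ofReal (3 * h ^ (s : ℝ)) * ‖w‖ₑ := by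
    have hzh : ‖z‖ ≤ h := (mem_ball_zero_iff.1 hz).le
    rw [← ofReal_norm, ← ofReal_norm, ← ENNReal.ofReal_mul (by positivity)]
    refine ENNReal.ofReal_le_ofReal ((norm_translationSub_toL2_le hΩ z w).trans ?_)
    gcongr
    exact s.2.1.le
  calc ∫⁻ x in Ω, ‖Ω.indicator (toL2 w) (x + z) - Ω.indicator (toL2 w) x‖ₑ
      ≤ ‖translationSub hΩ z (toL2 w)‖ₑ * volume Ω ^ (1 - 1 / (2 : ℝ≥0∞).toReal) :=
        setLIntegral_indicator_add_sub_le hΩ z _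
    _ ≤ ENNReal.ofReal (3 * h ^ (s : ℝ)) * ‖w‖ₑ * volume Ω ^ (1 / 2 : ℝ) := by
        rw [ENNReal.toReal_ofNat, sub_half]
        gcongr
    _ = ENNReal.ofReal (3 * h ^ (s : ℝ)) * volume Ω ^ (1 / 2 : ℝ) * ‖w‖ₑ := mul_right_comm _ _ _

theorem hasSolution [Nontrivial (Eucl d)] (hΩ : IsOpen Ω) (hΩb : Bornology.IsBounded Ω)
    {F : SpecHs Ω s → ℝ} (hF : IsWeaklySeqLSC F) (hF_minorant : HasAffineMinorant F) {α β : ℝ}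
    (hα : 0 < α) (hβ : 0 ≤ β) : HasSolution Ω (fun w => toL2 w) F α β := by
  obtain ⟨C, hC⟩ := exists_norm_toL2_le hΩ.measurableSet hΩb s
  have : CompleteSpace (SpecHs Ω s) := completeSpace_of_norm_toL2_le hC
  have hμ : volume Ω ≠ ⊤ := hΩb.measure_lt_top.ne
  have hlim : Tendsto (fun h : ℝ => ENNReal.ofReal (3 * h ^ (s : ℝ)) * volume Ω ^ (1 / 2 : ℝ))
      (𝓝[>] 0) (𝓝 0) := by
    simpa using ENNReal.Tendsto.mul_const
      (ENNReal.tendsto_ofReal ((tendsto_rpow_nhdsGT_zero s.2.1).const_mul 3))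
      (.inr (ENNReal.rpow_ne_top_of_nonneg (by positivity) hμ))
  exact hasSolution_of_meanOscillation_le hΩ subset_rfl hμ (toL2.mkContinuous C hC) hlim
    (fun h hh w => meanOscillation_toL2_le hΩ.measurableSet hh w) hF hF_minorant hα hβ

end SpecHs

end SpectralSpace

end FracSob

end

theorem mainTheorem9_general {d : ℕ} (hd : 1 ≤ d) {Ω : Set (Eucl d)} (hΩ : IsOpen Ω)
    (hΩb : Bornology.IsBounded Ω) (s : Set.Ioo (0 : ℝ) 1) {α β : ℝ} (hα : 0 < α) (hβ : 0 ≤ β) :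
    (∀ F : H0s Ω s → ℝ, IsWeaklySeqLSC F → HasAffineMinorant F →
      HasSolution Ω (fun w => Hs.toL2 w.1) F α β) ∧
    (∀ F : HTilde Ω s → ℝ, IsWeaklySeqLSC F → HasAffineMinorant F →
      HasSolution Ω (fun w => Hs.toL2 w.1) F α β) ∧
    (∀ F : SpecHs Ω s → ℝ, IsWeaklySeqLSC F → HasAffineMinorant F →
      HasSolution Ω (fun w => SpecHs.toL2 w) F α β) := by
  have hμ : volume Ω ≠ ⊤ := hΩb.measure_lt_top.ne
  have : NeZero d := NeZero.of_pos hd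
  refine ⟨fun F hF hF_minorant => ?_, fun F hF hF_minorant => ?_, fun F hF hF_minorant => ?_⟩
  · exact hasSolution_of_isClosed_submodule hΩ subset_rfl hμ
      (Submodule.isClosed_topologicalClosure _) hF hF_minorant hα hβ
  · exact hasSolution_of_isClosed_submodule hΩ (Set.subset_univ Ω) hμ (isClosed_HTilde s)
      hF hF_minorant hα hβ
  · exact SpecHs.hasSolution hΩ hΩb hF hF_minorant hα hβ

theorem mainTheorem9 {d : ℕ} (hd : 1 ≤ d) (Ω : Set (Eucl d)) (hΩ : IsBoundedLipschitzDomain Ω)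
    (s : Set.Ioo (0 : ℝ) 1) (hs : (s : ℝ) ≠ 1 / 2) (α β : ℝ) (hα : 0 < α) (hβ : 0 < β) :
    -- `W = H_0^s(Ω)` with the inner product of `H^s(Ω)`
    (∀ F : H0s Ω s → ℝ, IsAdmissible F → HasSolution Ω (fun w => Hs.toL2 w.1) F α β) ∧
    -- `W = H̃^s(Ω)` with the inner product of `H^s(ℝ^d)`
    (∀ F : HTilde Ω s → ℝ, IsAdmissible F → HasSolution Ω (fun w => Hs.toL2 w.1) F α β) ∧
    -- `W = ℍ^s(Ω)` with the spectral inner product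
    (∀ F : SpecHs Ω s → ℝ, IsAdmissible F →
      HasSolution Ω (fun w => SpecHs.toL2 w) F α β) := by
  obtain ⟨hH0s, hHTilde, hSpecHs⟩ := mainTheorem9_general hd hΩ.isOpen hΩ.isBounded s hα hβ.le
  exact ⟨fun F hF => hH0s F hF.weakly_lsc hF.bounded_below,
    fun F hF => hHTilde F hF.weakly_lsc hF.bounded_below,
    fun F hF => hSpecHs F hF.weakly_lsc hF.bounded_below⟩
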